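/- Let $B>0$ and let $v:\mathbb{R}\to\mathbb{R}$ satisfy $v\in L^2(\mathbb{R})$ and $v\neq 0$ (that is, $v$ does not vanish almost everywhere). For a potential $w\in L^2(\mathbb{R})$ and $p\in\mathbb{R}$ consider on $L^2(\mathbb{R})$ the operator $$h_w(p)=-\partial_x^2+(p+Bx)^2+w(x),$$ with domain consisting of all $\psi\in L^2(\mathbb{R})$ for which $h_w(p)\psi$, understood in the sense of distributions, belongs to $L^2(\mathbb{R})$. For $j\in\mathbb{N}_0$ let $\epsilon_j(p;w)$ be the $j$-th eigenvalue of $h_w(p)$ in increasing order, that is, the eigenvalue below which there are exactly $j$ eigenvalues of $h_w(p)$ (the eigenvalues of $h_w(p)$ are simple). Then for every $n\in\mathbb{N}_0$ there is a $\lambda_n>0$ such that for all $\lambda\in(0,\lambda_n)$ and all $j=0,1,\dots,n$ the eigenvalue $\epsilon_j(p;\lambda v)$ exists for every $p\in\mathbb{R}$, and the function $p\mapsto\epsilon_j(p;\lambda v)$ is not constant on $\mathbb{R}$. -/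

import Mathlib

open MeasureTheory
open scoped ContDiff

noncomputable section

namespace LandauFiber

/-- The Hilbert space `L²(ℝ)` of complex-valued functions. -/
abbrev L2 : Type := Lp ℂ 2 (volume : Measure ℝ)

/-- The total potential `x ↦ (p + B x)² + v(x)` of the fiber operator. -/
def potential (B : ℝ) (v : ℝ → ℝ) (p x : ℝ) : ℝ := (p + B * x) ^ 2 + v x

/-- `φ` is a test function, that is, an element of `C₀^∞(ℝ)`. -/
def IsTest (φ : ℝ → ℝ) : Prop := ContDiff ℝ ∞ φ ∧ HasCompactSupport φ

/-- `-ψ'' + ((p + B x)² + v) ψ = g` in the sense of distributions on `ℝ`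
(where the product of the potential with `ψ` is required to be a regular distribution). -/
def DistribEq (B : ℝ) (v : ℝ → ℝ) (p : ℝ) (ψ g : L2) : Prop :=
  LocallyIntegrable (fun x => potential B v p x • ψ x) volume ∧
    ∀ φ : ℝ → ℝ, IsTest φ →
      -(∫ x, deriv (deriv φ) x • ψ x) + (∫ x, φ x • (potential B v p x • ψ x))
        = ∫ x, φ x • g x

theorem L2.locallyIntegrable (ψ : L2) : LocallyIntegrable (ψ : ℝ → ℂ) volume :=
  (Lp.memLp ψ).locallyIntegrable (by norm_num)

theorem IsTest.integrable_smul {φ : ℝ → ℝ} (hφ : IsTest φ) {f : ℝ → ℂ}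
    (hf : LocallyIntegrable f volume) : Integrable (fun x => φ x • f x) volume :=
  hf.integrable_smul_left_of_hasCompactSupport hφ.1.continuous hφ.2

theorem IsTest.deriv {φ : ℝ → ℝ} (hφ : IsTest φ) : IsTest (deriv φ) :=
  ⟨(contDiff_infty_iff_deriv.1 hφ.1).2, hφ.2.deriv⟩

/-- The graph of the maximal realization of `-∂ₓ² + (p + B x)² + v(x)` in `L²(ℝ)`. -/
def fiberGraph (B : ℝ) (v : ℝ → ℝ) (p : ℝ) : Submodule ℂ (L2 × L2) where
  carrier := {z | DistribEq B v p z.1 z.2}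
  zero_mem' := by
    have h0 : ((0 : L2) : ℝ → ℂ) =ᵐ[volume] 0 := Lp.coeFn_zero _ _ _
    have hz : (fun x => potential B v p x • ((0 : L2) : ℝ → ℂ) x) =ᵐ[volume] fun _ => (0 : ℂ) := by
      filter_upwards [h0] with x _
      simp
    have hc : ∀ f : ℝ → ℝ, ∫ x, f x • ((0 : L2) : ℝ → ℂ) x = 0 := fun f => by
      rw [← integral_zero ℝ ℂ]
      apply integral_congr_ae
      filter_upwards [h0] with x _
      simp
    refine ⟨(locallyIntegrable_zero (ε'' := ℂ)).congr hz.symm, fun φ _ => ?_⟩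
    have h2 : ∫ x, φ x • (potential B v p x • ((0 : L2) : ℝ → ℂ) x) = 0 := by
      simpa only [smul_smul] using hc (fun x => φ x * potential B v p x)
    simp only [Prod.fst_zero, Prod.snd_zero]
    rw [hc, hc, h2]; simp
  add_mem' := by
    rintro ⟨ψ₁, g₁⟩ ⟨ψ₂, g₂⟩ ⟨hl₁, h₁⟩ ⟨hl₂, h₂⟩
    have hψ := Lp.coeFn_add ψ₁ ψ₂
    have hg := Lp.coeFn_add g₁ g₂
    refine ⟨(hl₁.add hl₂).congr ?_, fun φ hφ => ?_⟩
    · filter_upwards [hψ] with x hx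
      simp only [Prod.fst_add, hx, Pi.add_apply, smul_add]
    · have e1 : ∫ x, deriv (deriv φ) x • (ψ₁ + ψ₂ : L2) x
          = (∫ x, deriv (deriv φ) x • ψ₁ x) + ∫ x, deriv (deriv φ) x • ψ₂ x := by
        rw [← integral_add (hφ.deriv.deriv.integrable_smul (L2.locallyIntegrable ψ₁))
          (hφ.deriv.deriv.integrable_smul (L2.locallyIntegrable ψ₂))]
        apply integral_congr_ae
        filter_upwards [hψ] with x hx
        simp only [hx, Pi.add_apply, smul_add]
      have e2 : ∫ x, φ x • (potential B v p x • (ψ₁ + ψ₂ : L2) x)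
          = (∫ x, φ x • (potential B v p x • ψ₁ x)) + ∫ x, φ x • (potential B v p x • ψ₂ x) := by
        rw [← integral_add (hφ.integrable_smul hl₁) (hφ.integrable_smul hl₂)]
        apply integral_congr_ae
        filter_upwards [hψ] with x hx
        simp only [hx, Pi.add_apply, smul_add]
      have e3 : ∫ x, φ x • (g₁ + g₂ : L2) x = (∫ x, φ x • g₁ x) + ∫ x, φ x • g₂ x := by
        rw [← integral_add (hφ.integrable_smul (L2.locallyIntegrable g₁))
          (hφ.integrable_smul (L2.locallyIntegrable g₂))]
        apply integral_congr_ae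
        filter_upwards [hg] with x hx
        simp only [hx, Pi.add_apply, smul_add]
      have a1 := h₁ φ hφ
      have a2 := h₂ φ hφ
      simp only at a1 a2
      simp only [Prod.mk_add_mk]
      rw [e1, e2, e3, ← a1, ← a2]
      ring
  smul_mem' := by
    rintro c ⟨ψ, g⟩ ⟨hl, h⟩
    have hψ := Lp.coeFn_smul c ψ
    have hg := Lp.coeFn_smul c g
    refine ⟨(hl.smul c).congr ?_, fun φ hφ => ?_⟩
    · filter_upwards [hψ] with x hx
      simp only [Pi.smul_apply, Prod.smul_fst, hx]
      rw [smul_comm]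
    · have e1 : ∫ x, deriv (deriv φ) x • (c • ψ : L2) x
          = c • ∫ x, deriv (deriv φ) x • ψ x := by
        rw [← integral_smul]
        apply integral_congr_ae
        filter_upwards [hψ] with x hx
        simp only [hx, Pi.smul_apply]
        rw [smul_comm]
      have e2 : ∫ x, φ x • (potential B v p x • (c • ψ : L2) x)
          = c • ∫ x, φ x • (potential B v p x • ψ x) := by
        rw [← integral_smul]
        apply integral_congr_ae
        filter_upwards [hψ] with x hx
        simp only [hx, Pi.smul_apply]
        rw [smul_comm _ c, smul_comm _ c]
      have e3 : ∫ x, φ x • (c • g : L2) x = c • ∫ x, φ x • g x := by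
        rw [← integral_smul]
        apply integral_congr_ae
        filter_upwards [hg] with x hx
        simp only [hx, Pi.smul_apply]
        rw [smul_comm]
      have a1 := h φ hφ
      simp only at a1
      simp only [Prod.smul_mk]
      rw [e1, e2, e3, ← a1, smul_add, smul_neg]

/-- The graph is single-valued, so it is the graph of an operator. -/
theorem fiberGraph_single_valued (B : ℝ) (v : ℝ → ℝ) (p : ℝ) (z : L2 × L2)
    (hz : z ∈ fiberGraph B v p) (hz1 : z.1 = 0) : z.2 = 0 := by
  obtain ⟨ψ, g⟩ := z
  obtain rfl : ψ = 0 := hz1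
  obtain ⟨_, h⟩ := hz
  obtain ⟨_, h0⟩ := (fiberGraph B v p).zero_mem
  have : (g : ℝ → ℂ) =ᵐ[volume] 0 := by
    apply ae_eq_zero_of_integral_contDiff_smul_eq_zero (L2.locallyIntegrable g)
    intro φ hφ hc
    have a := h φ ⟨hφ, hc⟩
    have b := h0 φ ⟨hφ, hc⟩
    simp only [Prod.fst_zero, Prod.snd_zero] at a b
    rw [← a, b, ← integral_zero ℝ ℂ]
    apply integral_congr_ae
    filter_upwards [Lp.coeFn_zero ℂ 2 (volume : Measure ℝ)] with x hx
    simp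
  exact (Lp.eq_zero_iff_ae_eq_zero).2 this

/-- The fiber operator `h_v(p) = -∂ₓ² + (p + B x)² + v(x)` in `L²(ℝ)`, with its maximal domain
`{ψ ∈ L²(ℝ) : h_v(p) ψ ∈ L²(ℝ)}`, the expression `h_v(p) ψ` being understood in the sense of
distributions. -/
def fiberOperator (B : ℝ) (v : ℝ → ℝ) (p : ℝ) : L2 →ₗ.[ℂ] L2 :=
  (fiberGraph B v p).toLinearPMap

theorem fiberOperator_graph (B : ℝ) (v : ℝ → ℝ) (p : ℝ) :
    (fiberOperator B v p).graph = fiberGraph B v p :=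
  Submodule.toLinearPMap_graph_eq _ fun z hz h => fiberGraph_single_valued B v p z hz h

/-- The real number `E` is an eigenvalue of the operator `T` in `L²(ℝ)`. -/
def IsEigenvalue (T : L2 →ₗ.[ℂ] L2) (E : ℝ) : Prop :=
  ∃ ψ : T.domain, (ψ : L2) ≠ 0 ∧ T ψ = (E : ℂ) • (ψ : L2)

/-- `E` is the eigenvalue number `j` of `T`, when the eigenvalues are listed in increasing order
starting with number `0`: it is an eigenvalue, and exactly `j` eigenvalues lie below it. -/
def IsNthEigenvalue (T : L2 →ₗ.[ℂ] L2) (j : ℕ) (E : ℝ) : Prop :=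
  IsEigenvalue T E ∧ {E' : ℝ | IsEigenvalue T E' ∧ E' < E}.encard = j

theorem IsNthEigenvalue.unique {T : L2 →ₗ.[ℂ] L2} {j : ℕ} {E E' : ℝ}
    (h : IsNthEigenvalue T j E) (h' : IsNthEigenvalue T j E') : E = E' := by
  have key : ∀ {a b : ℝ}, IsNthEigenvalue T j a → IsNthEigenvalue T j b → ¬ a < b := by
    intro a b ha hb hab
    have hsub : {x : ℝ | IsEigenvalue T x ∧ x < a} ⊂ {x : ℝ | IsEigenvalue T x ∧ x < b} :=
      ⟨fun x hx => ⟨hx.1, hx.2.trans hab⟩, fun hh => lt_irrefl a (hh ⟨ha.1, hab⟩).2⟩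
    have hfin : {x : ℝ | IsEigenvalue T x ∧ x < a}.Finite :=
      Set.finite_of_encard_eq_coe ha.2
    have := hfin.encard_lt_encard hsub
    rw [ha.2, hb.2] at this
    exact lt_irrefl _ this
  exact le_antisymm (not_lt.1 (key h' h)) (not_lt.1 (key h h'))

open Classical in
/-- The eigenvalue branch `p ↦ ε_j(p; v)`: the eigenvalue number `j` of `h_v(p)`
(with the value `0` if there is no such eigenvalue). -/
def eigenvalueBranch (B : ℝ) (v : ℝ → ℝ) (j : ℕ) (p : ℝ) : ℝ :=
  if h : ∃ E : ℝ, IsNthEigenvalue (fiberOperator B v p) j E then h.choose else 0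

end LandauFiber

end

/-! For `w = 0` the fiber operator is a harmonic oscillator centred at `-p / B`. Its eigenvalues
`level B k = B (2k + 1)` do not depend on `p`, and its eigenfunctions are the translated Hermite
functions `landauFun B k (x + p / B)`. First order perturbation theory suggests that the `j`-th
eigenvalue for `w = λ v` is `level B j + λ c_j(p / B) + O(λ²)`, where `c_j(s) = ∫ v(x) φ_j(x + s)²
dx` and `φ_j = landauFun B j`. If the error is uniform in `p` and `c_j` is not constant, the branch
is not constant for small `λ`.

Uniformity: let `R` be the inverse of the unperturbed operator and `K` multiplication by `w` after
`R`. The bound `φ_k² ≤ 2 √(level B k)` (`landauFun_sq_le`) makes the vectors `w φ_k / level B k`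
square-summable, so `K` is Hilbert–Schmidt, with `‖K‖ ≤ δ = √(levelSum B * ∫ w²)` for every `p`.
When `δ < 1` the operator with its maximal domain is exactly `(1 + K) R⁻¹`
(`exists_isPerturbation`), so that `E` is an eigenvalue iff `a + K a = E R a` for some `a ≠ 0`. A
contraction argument yields a solution near each low level together with its first order expansion
(`exists_isLevel`). Orthogonality of eigenvectors shows that there is no other near that level
(`eq_of_isLevel`), which fixes the numbering (`exists_levels_encard`).

Nonconstancy: `c_j` is the correlation of `v` with a polynomial times a Gaussian, hence the Fourier
transform of an integrable product of the transforms of the two factors. If constant, it is zero by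
Riemann–Lebesgue, so the product vanishes almost everywhere. The transform of a nonzero polynomial
times a Gaussian has finitely many zeros, so `v = 0`, a contradiction
(`exists_integral_mul_polyGauss_ne`). -/

/-! ### Bounded operators described by coefficients in a Hilbert basis -/

section HilbertBasisTools

open scoped InnerProductSpace

variable {H : Type*} [NormedAddCommGroup H] [InnerProductSpace ℂ H]

namespace HilbertBasis

theorem hasSum_norm_inner_sq (b : HilbertBasis ℕ ℂ H) (x : H) :
    HasSum (fun k => ‖⟪b k, x⟫_ℂ‖ ^ 2) (‖x‖ ^ 2) := by
  have h := (b.hasSum_inner_mul_inner x x).mapL Complex.reCLM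
  have e : Complex.reCLM ⟪x, x⟫_ℂ = ‖x‖ ^ 2 := by
    simpa using inner_self_eq_norm_sq (𝕜 := ℂ) x
  rw [e] at h
  refine h.congr_fun ?_
  intro k
  rw [← inner_conj_symm x (b k)]
  simp only [Complex.reCLM_apply, ← Complex.normSq_eq_conj_mul_self, Complex.ofReal_re,
    Complex.normSq_eq_norm_sq]

theorem ext_inner (b : HilbertBasis ℕ ℂ H) {x y : H} (h : ∀ k, ⟪b k, x⟫_ℂ = ⟪b k, y⟫_ℂ) :
    x = y := by
  apply b.repr.injective
  ext k
  simpa [b.repr_apply_apply] using h k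

theorem clm_ext (b : HilbertBasis ℕ ℂ H) {F : Type*} [NormedAddCommGroup F] [NormedSpace ℂ F]
    {S T : H →L[ℂ] F} (h : ∀ k, S (b k) = T (b k)) : S = T := by
  apply ContinuousLinearMap.ext_on (s := Set.range b)
  · rw [Submodule.dense_iff_topologicalClosure_eq_top]
    exact b.dense_span
  · rintro _ ⟨k, rfl⟩
    exact h k

theorem inner_diagonal_left (b : HilbertBasis ℕ ℂ H) {T : H →L[ℂ] H} {d : ℕ → ℝ}
    (hT : ∀ x k, ⟪b k, T x⟫_ℂ = d k * ⟪b k, x⟫_ℂ) (x y : H) : ⟪T x, y⟫_ℂ = ⟪x, T y⟫_ℂ := by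
  rw [← b.tsum_inner_mul_inner, ← b.tsum_inner_mul_inner x]
  refine tsum_congr fun k => ?_
  rw [hT, ← inner_conj_symm, hT, map_mul, Complex.conj_ofReal, inner_conj_symm]
  ring

/-- An operator is determined by square-summable coefficient functionals. -/
theorem exists_clm_of_coeff (b : HilbertBasis ℕ ℂ H) (L : ℕ → H →ₗ[ℂ] ℂ) {C : ℝ} (hC : 0 ≤ C)
    (hL : ∀ x, Summable (fun k => ‖L k x‖ ^ 2) ∧ ∑' k, ‖L k x‖ ^ 2 ≤ (C * ‖x‖) ^ 2) :
    ∃ A : H →L[ℂ] H, (∀ x k, ⟪b k, A x⟫_ℂ = L k x) ∧ ‖A‖ ≤ C := by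
  have hmem : ∀ x, Memℓp (fun k => L k x) 2 := fun x => by
    refine memℓp_gen ?_
    simpa using (hL x).1
  let A₀ : H → H := fun x => b.repr.symm ⟨fun k => L k x, hmem x⟩
  have hA₀ : ∀ x k, ⟪b k, A₀ x⟫_ℂ = L k x := fun x k => by
    rw [← b.repr_apply_apply]
    simp [A₀]
  let A₁ : H →ₗ[ℂ] H :=
    { toFun := A₀
      map_add' := fun x y => b.ext_inner fun k => by simp [hA₀]
      map_smul' := fun c x => b.ext_inner fun k => by simp [hA₀] }
  have hb : ∀ x, ‖A₁ x‖ ≤ C * ‖x‖ := fun x => by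
    refine le_of_sq_le_sq ?_ (by positivity)
    rw [← (b.hasSum_norm_inner_sq (A₁ x)).tsum_eq]
    refine le_trans (le_of_eq ?_) (hL x).2
    exact tsum_congr fun k => by rw [← hA₀ x k]; rfl
  exact ⟨A₁.mkContinuous C hb, fun x k => hA₀ x k, A₁.mkContinuous_norm_le hC hb⟩

theorem exists_diagonal (b : HilbertBasis ℕ ℂ H) (d : ℕ → ℝ) {D : ℝ} (hd : ∀ k, |d k| ≤ D) :
    ∃ T : H →L[ℂ] H, (∀ x k, ⟪b k, T x⟫_ℂ = d k * ⟪b k, x⟫_ℂ) ∧ ‖T‖ ≤ D := by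
  have hD : 0 ≤ D := (abs_nonneg _).trans (hd 0)
  have hle : ∀ x k, ‖(d k : ℂ) * ⟪b k, x⟫_ℂ‖ ^ 2 ≤ D ^ 2 * ‖⟪b k, x⟫_ℂ‖ ^ 2 := fun x k => by
    rw [norm_mul, mul_pow, Complex.norm_real, Real.norm_eq_abs]
    gcongr
    exact hd k
  have hs : ∀ x, Summable fun k => ‖(d k : ℂ) * ⟪b k, x⟫_ℂ‖ ^ 2 := fun x =>
    .of_nonneg_of_le (fun _ => by positivity) (hle x)
      ((b.hasSum_norm_inner_sq x).summable.mul_left _)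
  obtain ⟨T, h1, h2⟩ := b.exists_clm_of_coeff
    (fun k => (d k : ℂ) • ((innerSL ℂ (b k) : H →L[ℂ] ℂ) : H →ₗ[ℂ] ℂ)) hD (fun x => by
      refine ⟨by simpa using hs x, ?_⟩
      calc _ = ∑' k, ‖(d k : ℂ) * ⟪b k, x⟫_ℂ‖ ^ 2 := by simp
        _ ≤ ∑' k, D ^ 2 * ‖⟪b k, x⟫_ℂ‖ ^ 2 :=
          (hs x).tsum_le_tsum (hle x) ((b.hasSum_norm_inner_sq x).summable.mul_left _)
        _ = _ := by rw [tsum_mul_left, (b.hasSum_norm_inner_sq x).tsum_eq, mul_pow])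
  exact ⟨T, fun x k => by simpa using h1 x k, h2⟩

/-- The operator with rows `y k`, which are square-summable. -/
theorem exists_clm_of_rows (b : HilbertBasis ℕ ℂ H) (y : ℕ → H) {C : ℝ} (hC : 0 ≤ C)
    (hy : Summable fun k => ‖y k‖ ^ 2) (hyC : ∑' k, ‖y k‖ ^ 2 ≤ C ^ 2) :
    ∃ A : H →L[ℂ] H, (∀ x k, ⟪b k, A x⟫_ℂ = ⟪y k, x⟫_ℂ) ∧ ‖A‖ ≤ C := by
  have hle : ∀ x k, ‖⟪y k, x⟫_ℂ‖ ^ 2 ≤ ‖y k‖ ^ 2 * ‖x‖ ^ 2 := fun x k => by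
    rw [← mul_pow]
    gcongr
    exact norm_inner_le_norm _ _
  have hs : ∀ x, Summable fun k => ‖⟪y k, x⟫_ℂ‖ ^ 2 := fun x =>
    .of_nonneg_of_le (fun _ => by positivity) (hle x) (hy.mul_right _)
  obtain ⟨T, h1, h2⟩ := b.exists_clm_of_coeff
    (fun k => ((innerSL ℂ (y k) : H →L[ℂ] ℂ) : H →ₗ[ℂ] ℂ)) hC (fun x => by
      refine ⟨by simpa using hs x, ?_⟩
      calc _ = ∑' k, ‖⟪y k, x⟫_ℂ‖ ^ 2 := by simp
        _ ≤ ∑' k, ‖y k‖ ^ 2 * ‖x‖ ^ 2 := (hs x).tsum_le_tsum (hle x) (hy.mul_right _)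
        _ ≤ _ := by rw [tsum_mul_right, mul_pow]; gcongr)
  exact ⟨T, fun x k => by simpa using h1 x k, h2⟩

end HilbertBasis

end HilbertBasisTools

/-! ### Abstract perturbation theory around the Landau levels -/

section Perturbation

open scoped InnerProductSpace

namespace LandauFiber

/-- The `k`-th Landau level. -/
def level (B : ℝ) (k : ℕ) : ℝ := B * (2 * k + 1)

theorem le_level {B : ℝ} (hB : 0 < B) (k : ℕ) : B ≤ level B k := by
  unfold level
  nlinarith [mul_nonneg hB.le (Nat.cast_nonneg (α := ℝ) k)]

theorem level_pos {B : ℝ} (hB : 0 < B) (k : ℕ) : 0 < level B k := hB.trans_le (le_level hB k)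

/-- The distance from `E` to `level B m` is at least `B (2 |m - k| - 1)`. The ratio is worst at `m =
k + 1`, where the level is `B (2k + 3)` and the distance may shrink to `B`. The constant bounds the
reduced resolvent at level `k`. -/
theorem level_le_mul_abs_sub {B : ℝ} (hB : 0 < B) {k m : ℕ} (hmk : m ≠ k) {E : ℝ}
    (hE : |E - level B k| ≤ B) : level B m ≤ (2 * k + 3) * |level B m - E| := by
  unfold level at *
  rw [abs_le] at hE
  have hk : (0 : ℝ) ≤ k := Nat.cast_nonneg k
  have hm : (0 : ℝ) ≤ m := Nat.cast_nonneg m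
  rcases lt_or_gt_of_ne hmk with h | h
  · have h' : (m : ℝ) + 1 ≤ k := by exact_mod_cast h
    have : B ≤ |B * (2 * m + 1) - E| := by
      rw [abs_sub_comm]
      refine le_trans ?_ (le_abs_self _)
      nlinarith
    calc B * (2 * m + 1) ≤ (2 * k + 3) * B := by nlinarith
      _ ≤ _ := by gcongr
  · have h' : (k : ℝ) + 1 ≤ m := by exact_mod_cast h
    have : B * (2 * (m - k) - 1) ≤ |B * (2 * m + 1) - E| := by
      refine le_trans ?_ (le_abs_self _)
      nlinarith
    calc B * (2 * m + 1) ≤ (2 * k + 3) * (B * (2 * (m - k) - 1)) := by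
          obtain ⟨t, ht⟩ : ∃ t : ℝ, t = m - k - 1 := ⟨_, rfl⟩
          have ht0 : 0 ≤ t := by linarith
          have : (m : ℝ) = k + 1 + t := by linarith
          rw [this]
          have h1 : 0 ≤ B * (t * k) := by positivity
          have h2 : 0 ≤ B * t := by positivity
          nlinarith
      _ ≤ _ := by gcongr

variable {H : Type*} [NormedAddCommGroup H] [InnerProductSpace ℂ H]

/-- `R` is the inverse of the unperturbed operator, which is diagonal in the basis `b` with the
Landau levels as eigenvalues, and `K` is a symmetric perturbation composed with `R`. -/
structure IsPerturbation (b : HilbertBasis ℕ ℂ H) (B : ℝ) (R K : H →L[ℂ] H) (δ : ℝ) : Prop where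
  pos : 0 < B
  diag : ∀ x k, ⟪b k, R x⟫_ℂ = ((level B k)⁻¹ : ℝ) * ⟪b k, x⟫_ℂ
  symm : ∀ x y, ⟪R x, K y⟫_ℂ = ⟪K x, R y⟫_ℂ
  norm_le : ‖K‖ ≤ δ

/-- `E` is an eigenvalue of `(1 + K) R⁻¹`. -/
def IsLevel (R K : H →L[ℂ] H) (E : ℝ) : Prop := ∃ a, a ≠ 0 ∧ a + K a = (E : ℂ) • R a

namespace IsPerturbation

variable {b : HilbertBasis ℕ ℂ H} {B δ : ℝ} {R K : H →L[ℂ] H}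

theorem norm_K_apply_le (h : IsPerturbation b B R K δ) (x : H) : ‖K x‖ ≤ δ * ‖x‖ :=
  K.le_of_opNorm_le h.norm_le x

theorem nonneg (h : IsPerturbation b B R K δ) : 0 ≤ δ := (norm_nonneg _).trans h.norm_le

theorem norm_R_apply_le (h : IsPerturbation b B R K δ) (x : H) : ‖R x‖ ≤ B⁻¹ * ‖x‖ := by
  obtain ⟨T, hT, hTn⟩ := b.exists_diagonal (fun k => (level B k)⁻¹) (D := B⁻¹) (fun k => by
    rw [abs_of_pos (inv_pos.2 (level_pos h.pos k))]
    exact inv_anti₀ h.pos (le_level h.pos k))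
  have : R x = T x := b.ext_inner fun k => by rw [h.diag, hT]
  rw [this]
  exact T.le_of_opNorm_le hTn x

theorem R_basis (h : IsPerturbation b B R K δ) (k : ℕ) :
    R (b k) = (((level B k)⁻¹ : ℝ) : ℂ) • b k := b.ext_inner fun j => by
  rw [h.diag, inner_smul_right, orthonormal_iff_ite.1 b.orthonormal]
  split_ifs with hjk
  · rw [hjk]
  · simp

theorem R_symm (h : IsPerturbation b B R K δ) (x y : H) : ⟪R x, y⟫_ℂ = ⟪x, R y⟫_ℂ :=
  b.inner_diagonal_left h.diag x y

theorem R_injective (h : IsPerturbation b B R K δ) {x : H} (hx : R x = 0) : x = 0 :=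
  b.ext_inner fun k => by
    have := h.diag x k
    rw [hx, inner_zero_right, eq_comm, mul_eq_zero] at this
    rcases this with h0 | h0
    · exact absurd h0 (by exact_mod_cast (inv_pos.2 (level_pos h.pos k)).ne')
    · simpa using h0

theorem symm_add (h : IsPerturbation b B R K δ) (x y : H) :
    ⟪R x, y + K y⟫_ℂ = ⟪x + K x, R y⟫_ℂ := by
  rw [inner_add_right, inner_add_left, h.symm, h.R_symm]

/-- The eigenvectors of `(1 + K) R⁻¹` are `R x` and `R y`, not `x` and `y`; symmetry makes those
orthogonal. -/
theorem inner_R_eq_zero (h : IsPerturbation b B R K δ) {E E' : ℝ} (hE : E ≠ E') {x y : H}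
    (hx : x + K x = (E : ℂ) • R x) (hy : y + K y = (E' : ℂ) • R y) : ⟪R x, R y⟫_ℂ = 0 := by
  have := h.symm_add x y
  rw [hx, hy, inner_smul_left, inner_smul_right, Complex.conj_ofReal, ← sub_eq_zero, ← sub_mul,
    mul_eq_zero] at this
  rcases this with h0 | h0
  · exact absurd (by exact_mod_cast (sub_eq_zero.1 h0).symm) hE
  · exact h0

/-- An eigenvector near the `k`-th level is concentrated on the `k`-th basis vector. -/
theorem norm_sub_le (h : IsPerturbation b B R K δ) {k : ℕ} {E : ℝ} (hE : |E - level B k| ≤ B)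
    {x : H} (hx : x + K x = (E : ℂ) • R x) :
    ‖x - ⟪b k, x⟫_ℂ • b k‖ ≤ (2 * k + 3) * δ * ‖x‖ := by
  -- `T` is the reduced resolvent: away from index `k` the eigenvalue equation reads `(1 - E / level
  -- B m) x_m = -(K x)_m`.
  obtain ⟨T, hT, hTn⟩ := b.exists_diagonal
    (fun m => if m = k then 0 else level B m / (level B m - E)) (D := 2 * k + 3) (fun m => by
      split_ifs with hmk
      · simp; positivity
      · have := level_le_mul_abs_sub h.pos hmk hE
        have hpos : 0 < |level B m - E| := by
          by_contra! h0
          have := level_pos h.pos m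
          nlinarith [Nat.cast_nonneg (α := ℝ) k]
        rw [abs_div, abs_of_pos (level_pos h.pos m), div_le_iff₀ hpos]
        exact this)
  have e : x - ⟪b k, x⟫_ℂ • b k = T (-K x) := b.ext_inner fun m => by
    have hK : -K x = x - (E : ℂ) • R x := by rw [← hx]; abel
    rw [hT, hK, inner_sub_right, inner_sub_right, inner_smul_right, inner_smul_right, h.diag,
      orthonormal_iff_ite.1 b.orthonormal]
    split_ifs with hmk
    · rw [hmk]; simp
    · have h1 : (level B m : ℂ) ≠ 0 := by exact_mod_cast (level_pos h.pos m).ne'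
      have h2 : (level B m : ℂ) - E ≠ 0 := by
        intro h0
        have h0' : level B m - E = 0 := by exact_mod_cast h0
        have := level_le_mul_abs_sub h.pos hmk hE
        rw [h0'] at this
        have := level_pos h.pos m
        simp at *
        linarith
      push_cast
      field_simp
      ring
  rw [e, mul_assoc]
  refine (T.le_of_opNorm_le hTn _).trans ?_
  rw [norm_neg]
  gcongr
  exact h.norm_K_apply_le x

/-- Both eigenvectors are concentrated on `b k`, so the `b k` components of `R x` and `R y`
contribute more to their inner product than the remainders can cancel. This contradicts
orthogonality if the eigenvalues differ. -/
theorem eq_of_isLevel (h : IsPerturbation b B R K δ) {k : ℕ} (hδ : 8 * (2 * k + 3) ^ 2 * δ ≤ 1)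
    {E E' : ℝ} (hE : |E - level B k| ≤ B) (hE' : |E' - level B k| ≤ B)
    (hl : IsLevel R K E) (hl' : IsLevel R K E') : E = E' := by
  by_contra hne
  obtain ⟨x, hx0, hx⟩ := hl
  obtain ⟨y, hy0, hy⟩ := hl'
  have horth := h.inner_R_eq_zero hne hx hy
  have hnx := h.norm_sub_le hE hx
  have hny := h.norm_sub_le hE' hy
  set α := ⟪b k, x⟫_ℂ with hα
  set β := ⟪b k, y⟫_ℂ with hβ
  set r := x - α • b k with hr
  set s := y - β • b k with hs
  have hbk : ‖b k‖ = 1 := b.orthonormal.1 k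
  have hbb : ⟪b k, b k⟫_ℂ = 1 := by simp [hbk]
  have hbr : ⟪b k, r⟫_ℂ = 0 := by rw [hr, inner_sub_right, inner_smul_right, hbb]; simp [hα]
  have hbs : ⟪b k, s⟫_ℂ = 0 := by rw [hs, inner_sub_right, inner_smul_right, hbb]; simp [hβ]
  have hx' : x = α • b k + r := by rw [hr]; abel
  have hy' : y = β • b k + s := by rw [hs]; abel
  have hrb : ⟪R r, b k⟫_ℂ = 0 := by rw [← inner_conj_symm, h.diag, hbr]; simp
  have key : (starRingEnd ℂ) α * β * ((level B k)⁻¹ : ℝ) ^ 2 = - ⟪R r, R s⟫_ℂ := by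
    rw [eq_neg_iff_add_eq_zero, ← horth, hx', hy']
    simp only [map_add, map_smul, inner_add_left, inner_add_right, inner_smul_left,
      inner_smul_right, h.R_basis, h.diag, hbs, hrb, hbb, Complex.conj_ofReal]
    ring
  have hk := congrArg norm key
  have hμ := level_pos h.pos k
  rw [norm_neg, norm_mul, norm_mul, norm_pow, Complex.norm_conj, Complex.norm_real,
    Real.norm_eq_abs, abs_of_pos (inv_pos.2 hμ)] at hk
  have hRR : ‖⟪R r, R s⟫_ℂ‖ ≤ (B⁻¹ * ‖r‖) * (B⁻¹ * ‖s‖) :=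
    (norm_inner_le_norm _ _).trans (mul_le_mul (h.norm_R_apply_le r) (h.norm_R_apply_le s)
      (norm_nonneg _) (mul_nonneg (inv_nonneg.2 h.pos.le) (norm_nonneg _)))
  have hx1 : 0 < ‖x‖ := norm_pos_iff.2 hx0
  have hy1 : 0 < ‖y‖ := norm_pos_iff.2 hy0
  obtain ⟨q, hq⟩ : ∃ q, q = (2 * (k : ℝ) + 3) * δ := ⟨_, rfl⟩
  rw [← hq] at hnx hny
  have hq0 : 0 ≤ q := by rw [hq]; have := h.nonneg; positivity
  have hk0 : (0 : ℝ) ≤ k := Nat.cast_nonneg k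
  have hq1 : 8 * (2 * (k : ℝ) + 3) * q ≤ 1 := by rw [hq]; linarith
  have hxα : (1 - q) * ‖x‖ ≤ ‖α‖ := by
    have := norm_add_le (α • b k) r
    rw [← hx', norm_smul, hbk, mul_one] at this
    linarith
  have hyβ : (1 - q) * ‖y‖ ≤ ‖β‖ := by
    have := norm_add_le (β • b k) s
    rw [← hy', norm_smul, hbk, mul_one] at this
    linarith
  have hq2 : q ≤ 1 / 8 := by nlinarith
  have c1 : (1 - q) * ‖x‖ * ((1 - q) * ‖y‖) * ((level B k)⁻¹) ^ 2
      ≤ (B⁻¹ * (q * ‖x‖)) * (B⁻¹ * (q * ‖y‖)) := by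
    have hB := h.pos
    have h1q : 0 ≤ 1 - q := by linarith
    calc _ ≤ ‖α‖ * ‖β‖ * ((level B k)⁻¹) ^ 2 := by gcongr
      _ = _ := hk
      _ ≤ _ := hRR
      _ ≤ _ := by gcongr
  have c2 : (1 - q) ^ 2 * ((level B k)⁻¹) ^ 2 ≤ (B⁻¹) ^ 2 * q ^ 2 := by
    have : 0 < ‖x‖ * ‖y‖ := by positivity
    refine le_of_mul_le_mul_right ?_ this
    linarith
  have hlev : level B k = B * (2 * k + 1) := rfl
  have hB := h.pos
  have c3 : (1 - q) ^ 2 ≤ q ^ 2 * (2 * k + 1) ^ 2 := by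
    rw [hlev] at c2
    have : (1 - q) ^ 2 * ((B * (2 * (k : ℝ) + 1))⁻¹) ^ 2
      = ((1 - q) ^ 2 / (2 * k + 1) ^ 2) * B⁻¹ ^ 2 := by field_simp
    rw [this, mul_comm (B⁻¹ ^ 2)] at c2
    have := le_of_mul_le_mul_right c2 (by positivity)
    rwa [div_le_iff₀ (by positivity)] at this
  rw [← mul_pow] at c3
  -- This says `1 ≤ q (2k + 2)`, contrary to `8 (2k + 3) q ≤ 1`.
  have c4 := le_of_sq_le_sq c3 (by positivity)
  nlinarith

/-- For `E ≤ 0` all ratios `level / (level - E)` are at most `1`, so an eigenvector would satisfy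
`‖x‖ ≤ ‖K x‖ ≤ δ ‖x‖`. -/
theorem pos_of_isLevel (h : IsPerturbation b B R K δ) (hδ : δ < 1) {E : ℝ}
    (hl : IsLevel R K E) : 0 < E := by
  by_contra! hE
  obtain ⟨x, hx0, hx⟩ := hl
  have hx1 : 0 < ‖x‖ := norm_pos_iff.2 hx0
  have hpos : ∀ m, 0 < level B m - E := fun m => by linarith [level_pos h.pos m]
  obtain ⟨T, hT, hTn⟩ := b.exists_diagonal (fun m => level B m / (level B m - E)) (D := 1)
    (fun m => by
      rw [abs_of_pos (div_pos (level_pos h.pos m) (hpos m)), div_le_one (hpos m)]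
      linarith)
  have e : x = T (-K x) := b.ext_inner fun m => by
    have hK : -K x = x - (E : ℂ) • R x := by rw [← hx]; abel
    rw [hT, hK, inner_sub_right, inner_smul_right, h.diag]
    have h1 : (level B m : ℂ) ≠ 0 := by exact_mod_cast (level_pos h.pos m).ne'
    have h2 : (level B m : ℂ) - E ≠ 0 := by exact_mod_cast (hpos m).ne'
    push_cast
    field_simp
  have := (T.le_of_opNorm_le hTn (-K x))
  rw [← e, norm_neg] at this
  have := h.norm_K_apply_le x
  nlinarith

/-- First order perturbation theory for the `k`-th level. -/
theorem exists_isLevel (h : IsPerturbation b B R K δ) [CompleteSpace H] {k : ℕ}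
    (hδ : 8 * (2 * k + 3) ^ 2 * δ ≤ 1) :
    ∃ E : ℝ, IsLevel R K E ∧
      |E - level B k * (1 + (⟪b k, K (b k)⟫_ℂ).re)| ≤ level B k * (4 * (2 * k + 3) ^ 2 * δ ^ 2) := by
  have hB := h.pos
  have hδ0 := h.nonneg
  have hμ := level_pos h.pos k
  have hk0 : (0 : ℝ) ≤ k := Nat.cast_nonneg k
  have hbk : ‖b k‖ = 1 := b.orthonormal.1 k
  have hbb : ⟪b k, b k⟫_ℂ = 1 := by simp [hbk]
  have hself : |level B k - level B k| ≤ B := by simpa using hB.le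
  have hne : ∀ m, m ≠ k → level B m - level B k ≠ 0 := fun m hmk h0 => by
    have := level_le_mul_abs_sub h.pos hmk hself
    rw [h0, abs_zero, mul_zero] at this
    linarith [level_pos h.pos m]
  obtain ⟨T, hT, hTn⟩ := b.exists_diagonal
    (fun m => if m = k then 0 else level B m / (level B m - level B k)) (D := 2 * k + 3)
    (fun m => by
      split_ifs with hmk
      · simp; positivity
      · rw [abs_div, abs_of_pos (level_pos h.pos m), div_le_iff₀ (abs_pos.2 (hne m hmk))]
        exact level_le_mul_abs_sub h.pos hmk hself)
  -- Lyapunov–Schmidt reduction: normalize the solution as `b k + u` with `u` orthogonal to `b k`.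
  -- The `k`-th coordinate of the equation forces `E = level B k * (1 + t u)`; the other coordinates
  -- say `u = Φ u`.
  let t : H → ℂ := fun u => ⟪b k, K (b k + u)⟫_ℂ
  let Φ : H → H := fun u => T (((level B k : ℂ) * t u) • R u - K (b k + u))
  have hTle : ∀ x, ‖T x‖ ≤ (2 * k + 3) * ‖x‖ := T.le_of_opNorm_le hTn
  have hle2 : ∀ u : H, ‖u‖ ≤ 1 → ‖b k + u‖ ≤ 2 := fun u hu =>
    (norm_add_le _ _).trans (by rw [hbk]; linarith)
  have ht : ∀ u : H, ‖u‖ ≤ 1 → ‖t u‖ ≤ 2 * δ := fun u hu => by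
    refine (norm_inner_le_norm _ _).trans ?_
    rw [hbk, one_mul]
    refine (h.norm_K_apply_le _).trans ?_
    rw [mul_comm]
    gcongr
    exact hle2 u hu
  have hμR : ∀ x : H, level B k * ‖R x‖ ≤ (2 * k + 1) * ‖x‖ := fun x => by
    calc _ ≤ level B k * (B⁻¹ * ‖x‖) := by gcongr; exact h.norm_R_apply_le x
      _ = _ := by unfold level; field_simp
  have hnΦ : ∀ u : H, ‖u‖ ≤ 1 → ‖Φ u‖ ≤ 4 * (2 * k + 3) ^ 2 * δ := fun u hu => by
    refine (hTle _).trans ?_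
    have h1 : ‖((level B k : ℂ) * t u) • R u - K (b k + u)‖
        ≤ (2 * k + 1) * (2 * δ) + δ * 2 := by
      refine (_root_.norm_sub_le _ _).trans (add_le_add ?_ ?_)
      · rw [norm_smul, norm_mul, Complex.norm_real, Real.norm_eq_abs, abs_of_pos hμ]
        calc level B k * ‖t u‖ * ‖R u‖ = (level B k * ‖R u‖) * ‖t u‖ := by ring
          _ ≤ ((2 * k + 1) * 1) * (2 * δ) :=
            mul_le_mul ((hμR u).trans (by gcongr)) (ht u hu) (norm_nonneg _) (by positivity)
          _ = _ := by ring
      · refine (h.norm_K_apply_le _).trans ?_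
        gcongr
        exact hle2 u hu
    calc _ ≤ (2 * (k : ℝ) + 3) * ((2 * k + 1) * (2 * δ) + δ * 2) := by gcongr
      _ ≤ _ := by nlinarith [mul_nonneg hk0 hδ0, mul_nonneg hk0 (mul_nonneg hk0 hδ0)]
  -- The Lipschitz constant comes out as `(2k + 3)(6k + 4) δ`, at most `4 (2k + 3)² δ ≤ 1 / 2`.
  have hLip : ∀ u v : H, ‖u‖ ≤ 1 → ‖v‖ ≤ 1 → ‖Φ u - Φ v‖ ≤ 1 / 2 * ‖u - v‖ := fun u v hu hv => by
    have hd : Φ u - Φ v = T (((level B k : ℂ) * t u) • R (u - v)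
        + ((level B k : ℂ) * ⟪b k, K (u - v)⟫_ℂ) • R v - K (u - v)) := by
      simp only [Φ, t, ← map_sub]
      congr 1
      simp only [map_sub, map_add, inner_add_right, inner_sub_right]
      module
    have hin : ‖⟪b k, K (u - v)⟫_ℂ‖ ≤ δ * ‖u - v‖ := by
      refine (norm_inner_le_norm _ _).trans ?_
      rw [hbk, one_mul]
      exact h.norm_K_apply_le _
    rw [hd]
    refine (hTle _).trans ?_
    have h1 : ‖((level B k : ℂ) * t u) • R (u - v)
        + ((level B k : ℂ) * ⟪b k, K (u - v)⟫_ℂ) • R v - K (u - v)‖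
        ≤ (2 * k + 1) * ‖u - v‖ * (2 * δ) + (2 * k + 1) * (δ * ‖u - v‖) + δ * ‖u - v‖ := by
      refine (_root_.norm_sub_le _ _).trans (add_le_add ((norm_add_le _ _).trans (add_le_add ?_ ?_)) ?_)
      · rw [norm_smul, norm_mul, Complex.norm_real, Real.norm_eq_abs, abs_of_pos hμ]
        calc level B k * ‖t u‖ * ‖R (u - v)‖ = (level B k * ‖R (u - v)‖) * ‖t u‖ := by ring
          _ ≤ _ := mul_le_mul (hμR _) (ht u hu) (norm_nonneg _) (by positivity)
      · rw [norm_smul, norm_mul, Complex.norm_real, Real.norm_eq_abs, abs_of_pos hμ]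
        calc level B k * ‖⟪b k, K (u - v)⟫_ℂ‖ * ‖R v‖
            = (level B k * ‖R v‖) * ‖⟪b k, K (u - v)⟫_ℂ‖ := by ring
          _ ≤ ((2 * k + 1) * 1) * (δ * ‖u - v‖) :=
            mul_le_mul ((hμR v).trans (by gcongr)) hin (norm_nonneg _) (by positivity)
          _ = _ := by ring
      · exact h.norm_K_apply_le _
    calc _ ≤ (2 * (k : ℝ) + 3) * ((2 * k + 1) * ‖u - v‖ * (2 * δ)
            + (2 * k + 1) * (δ * ‖u - v‖) + δ * ‖u - v‖) := by gcongr
      _ = ((2 * k + 3) * (6 * k + 4) * δ) * ‖u - v‖ := by ring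
      _ ≤ _ := by
        gcongr
        nlinarith [mul_nonneg hk0 hδ0, mul_nonneg hk0 (mul_nonneg hk0 hδ0)]
  have hmaps : Set.MapsTo Φ (Metric.closedBall 0 1) (Metric.closedBall 0 1) := fun u hu => by
    rw [mem_closedBall_zero_iff] at *
    refine (hnΦ u hu).trans ?_
    linarith
  obtain ⟨u, hu, hfix, -⟩ := ContractingWith.exists_fixedPoint' (K := 1 / 2) (x := 0)
    Metric.isClosed_closedBall.isComplete hmaps
    ⟨by norm_num, LipschitzWith.of_dist_le_mul fun x y => by
      rw [Subtype.dist_eq, Subtype.dist_eq, dist_eq_norm, dist_eq_norm]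
      simpa using hLip x y (mem_closedBall_zero_iff.1 x.2)
        (mem_closedBall_zero_iff.1 y.2)⟩
    (by simp) (edist_ne_top _ _)
  rw [mem_closedBall_zero_iff] at hu
  have hfix' : T (((level B k : ℂ) * t u) • R u - K (b k + u)) = u := hfix
  have hun : ‖u‖ ≤ 4 * (2 * k + 3) ^ 2 * δ := by
    have := hnΦ u hu
    rwa [hfix.eq] at this
  have hbu : ⟪b k, u⟫_ℂ = 0 := by rw [← hfix', hT]; simp
  have heig : (b k + u) + K (b k + u) = ((level B k : ℂ) * (1 + t u)) • R (b k + u) := by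
    refine b.ext_inner fun m => ?_
    rw [inner_add_right, inner_smul_right, h.diag]
    by_cases hmk : m = k
    · rw [hmk, inner_add_right, hbb, hbu]
      have : (level B k : ℂ) ≠ 0 := by exact_mod_cast hμ.ne'
      push_cast
      field_simp
      simp [t, inner_add_right]
    · have hu' : ⟪b m, u⟫_ℂ = _ := (congrArg (fun z => ⟪b m, z⟫_ℂ) hfix').symm
      rw [hT, if_neg hmk, inner_sub_right, inner_smul_right, h.diag] at hu'
      have hbm : ⟪b m, b k⟫_ℂ = 0 := by
        rw [orthonormal_iff_ite.1 b.orthonormal, if_neg hmk]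
      rw [inner_add_right, hbm, zero_add]
      have h1 : (level B m : ℂ) ≠ 0 := by exact_mod_cast (level_pos h.pos m).ne'
      have h2 : (level B m : ℂ) - level B k ≠ 0 := by exact_mod_cast hne m hmk
      push_cast at hu' ⊢
      field_simp at hu' ⊢
      linear_combination hu'
  have hx0 : b k + u ≠ 0 := fun h0 => by
    have := congrArg (fun z => ⟪b k, z⟫_ℂ) h0
    rw [inner_add_right, hbb, hbu, inner_zero_right] at this
    norm_num at this
  have hR0 : R (b k + u) ≠ 0 := fun h0 => hx0 (h.R_injective h0)
  -- The fixed point gives a complex eigenvalue only; symmetry makes it real.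
  have hreal : (starRingEnd ℂ) ((level B k : ℂ) * (1 + t u)) = (level B k : ℂ) * (1 + t u) := by
    have := h.symm_add (b k + u) (b k + u)
    rw [heig, inner_smul_left, inner_smul_right] at this
    exact (mul_right_cancel₀ (inner_self_ne_zero.2 hR0) this).symm
  obtain ⟨E, hE⟩ := Complex.conj_eq_iff_real.1 hreal
  refine ⟨E, ⟨b k + u, hx0, by rw [heig, hE]⟩, ?_⟩
  have hEre : E = level B k * (1 + (t u).re) := by
    have := congrArg Complex.re hE
    simpa using this.symm
  have : E - level B k * (1 + (⟪b k, K (b k)⟫_ℂ).re) = level B k * (⟪b k, K u⟫_ℂ).re := by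
    rw [hEre]
    simp only [t, map_add, inner_add_right, Complex.add_re]
    ring
  rw [this, abs_mul, abs_of_pos hμ]
  gcongr
  calc |(⟪b k, K u⟫_ℂ).re| ≤ ‖⟪b k, K u⟫_ℂ‖ := Complex.abs_re_le_norm _
    _ ≤ ‖b k‖ * ‖K u‖ := norm_inner_le_norm _ _
    _ ≤ δ * ‖u‖ := by rw [hbk, one_mul]; exact h.norm_K_apply_le u
    _ ≤ δ * (4 * (2 * k + 3) ^ 2 * δ) := by gcongr
    _ = _ := by ring

/-- The windows of radius `B` about the first `n + 1` levels cover `[0, 2B (n + 1)]`, and each holds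
exactly one eigenvalue. Negative eigenvalues are excluded, so nothing below the upper end is missed.
-/
theorem exists_levels (h : IsPerturbation b B R K δ) [CompleteSpace H] {n : ℕ}
    (hδ : 8 * (2 * n + 3) ^ 2 * δ ≤ 1) :
    ∃ E : ℕ → ℝ, (∀ k ≤ n, IsLevel R K (E k) ∧ |E k - level B k| < B ∧
      |E k - level B k * (1 + (⟪b k, K (b k)⟫_ℂ).re)|
        ≤ level B k * (4 * (2 * k + 3) ^ 2 * δ ^ 2)) ∧
      ∀ E', IsLevel R K E' → E' ≤ 2 * B * (n + 1) → ∃ k ≤ n, E' = E k := by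
  have hB := h.pos
  have hδ0 := h.nonneg
  have hδk : ∀ k : ℕ, k ≤ n → 8 * (2 * (k : ℝ) + 3) ^ 2 * δ ≤ 1 := fun k hk => by
    have : (k : ℝ) ≤ n := by exact_mod_cast hk
    refine le_trans ?_ hδ
    gcongr
  have hex : ∀ k : ℕ, ∃ E : ℝ, k ≤ n → IsLevel R K E ∧ |E - level B k| < B ∧
      |E - level B k * (1 + (⟪b k, K (b k)⟫_ℂ).re)|
        ≤ level B k * (4 * (2 * k + 3) ^ 2 * δ ^ 2) := fun k => by
    by_cases hk : k ≤ n
    · obtain ⟨E, h1, h2⟩ := h.exists_isLevel (hδk k hk)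
      refine ⟨E, fun _ => ⟨h1, ?_, h2⟩⟩
      have hbk : ‖b k‖ = 1 := b.orthonormal.1 k
      have hre : |(⟪b k, K (b k)⟫_ℂ).re| ≤ δ := by
        refine (Complex.abs_re_le_norm _).trans ((norm_inner_le_norm _ _).trans ?_)
        simpa [hbk] using h.norm_K_apply_le (b k)
      have hμ := level_pos hB k
      have hk0 : (0 : ℝ) ≤ k := Nat.cast_nonneg k
      have e : E - level B k = (E - level B k * (1 + (⟪b k, K (b k)⟫_ℂ).re))
          + level B k * (⟪b k, K (b k)⟫_ℂ).re := by ring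
      rw [e]
      refine (abs_add_le _ _).trans_lt ?_
      rw [abs_mul, abs_of_pos hμ]
      calc _ ≤ level B k * (4 * (2 * k + 3) ^ 2 * δ ^ 2) + level B k * δ := by gcongr
        _ ≤ level B k * (2 * δ) := by
          rw [← mul_add]
          gcongr
          nlinarith [hδk k hk]
        _ = B * ((2 * k + 1) * (2 * δ)) := by unfold level; ring
        _ < B * 1 := by
          gcongr
          nlinarith [hδk k hk, mul_nonneg hk0 hδ0, mul_nonneg hk0 (mul_nonneg hk0 hδ0)]
        _ = B := mul_one B
    · exact ⟨0, fun hk' => absurd hk' hk⟩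
  choose E hE using hex
  refine ⟨E, hE, fun E' hl hle => ?_⟩
  have hδ1 : δ < 1 := by
    nlinarith [Nat.cast_nonneg (α := ℝ) n,
      mul_nonneg (Nat.cast_nonneg (α := ℝ) n) hδ0,
      mul_nonneg (Nat.cast_nonneg (α := ℝ) n) (mul_nonneg (Nat.cast_nonneg (α := ℝ) n) hδ0)]
  have hpos := h.pos_of_isLevel hδ1 hl
  have hq : 0 ≤ E' / (2 * B) := by positivity
  have hkey : ∃ k ≤ n, |E' - level B k| ≤ B := by
    by_cases hlt : E' < 2 * B * (n + 1)
    · refine ⟨⌊E' / (2 * B)⌋₊, ?_, ?_⟩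
      · rw [← Nat.lt_add_one_iff, Nat.floor_lt hq, div_lt_iff₀ (by positivity)]
        push_cast
        linarith
      · have h1 := Nat.floor_le hq
        have h2 := Nat.lt_floor_add_one (E' / (2 * B))
        rw [le_div_iff₀ (by positivity)] at h1
        rw [div_lt_iff₀ (by positivity)] at h2
        unfold level
        rw [abs_le]
        constructor <;> linarith
    -- At the right endpoint the floor would be `n + 1`, yet the point still lies in the closed
    -- window of level `n`.
    · refine ⟨n, le_rfl, ?_⟩
      have : E' = 2 * B * (n + 1) := le_antisymm hle (not_lt.1 hlt)
      unfold level
      rw [this, abs_le]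
      constructor <;> linarith
  obtain ⟨k, hk, hEk⟩ := hkey
  exact ⟨k, hk, h.eq_of_isLevel (hδk k hk) hEk (hE k hk).2.1.le hl (hE k hk).1⟩

/-- For small perturbations the lowest eigenvalues are counted by the Landau levels. -/
theorem exists_levels_encard (h : IsPerturbation b B R K δ) [CompleteSpace H] {n : ℕ}
    (hδ : 8 * (2 * n + 3) ^ 2 * δ ≤ 1) :
    ∃ E : ℕ → ℝ, ∀ k ≤ n, IsLevel R K (E k) ∧ {E' | IsLevel R K E' ∧ E' < E k}.encard = k ∧
      |E k - level B k * (1 + (⟪b k, K (b k)⟫_ℂ).re)|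
        ≤ level B k * (4 * (2 * k + 3) ^ 2 * δ ^ 2) := by
  obtain ⟨E, hE, hall⟩ := h.exists_levels hδ
  have hB := h.pos
  have hlt : ∀ i j, i < j → j ≤ n → E i < E j := fun i j hij hj => by
    have h1 := abs_lt.1 (hE i (hij.le.trans hj)).2.1
    have h2 := abs_lt.1 (hE j hj).2.1
    have : (i : ℝ) + 1 ≤ j := by exact_mod_cast hij
    unfold level at h1 h2
    nlinarith
  refine ⟨E, fun k hk => ⟨(hE k hk).1, ?_, (hE k hk).2.2⟩⟩
  have hset : {E' | IsLevel R K E' ∧ E' < E k} = E '' (Finset.range k : Set ℕ) := by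
    ext E'
    simp only [Set.mem_ofPred_eq, Set.mem_image, Finset.coe_range, Set.mem_Iio]
    constructor
    · rintro ⟨hl, hlt'⟩
      have hk' : (k : ℝ) ≤ n := by exact_mod_cast hk
      have h2 := abs_lt.1 (hE k hk).2.1
      unfold level at h2
      obtain ⟨i, hi, rfl⟩ := hall E' hl (by nlinarith)
      refine ⟨i, ?_, rfl⟩
      by_contra! hki
      rcases hki.eq_or_lt with rfl | hki
      · exact lt_irrefl _ hlt'
      · exact lt_asymm hlt' (hlt k i hki hi)
    · rintro ⟨i, hi, rfl⟩
      exact ⟨(hE i (hi.le.trans hk)).1, hlt i k hi hk⟩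
  have hinj : Set.InjOn E (Finset.range k : Set ℕ) := by
    intro i hi j hj hij
    simp only [Finset.coe_range, Set.mem_Iio] at hi hj
    rcases lt_trichotomy i j with h' | h' | h'
    · exact absurd hij (hlt i j h' (hj.le.trans hk)).ne
    · exact h'
    · exact absurd hij (hlt j i h' (hi.le.trans hk)).ne'
  rw [hset, hinj.encard_image, Set.encard_coe_eq_coe_finsetCard, Finset.card_range]

end IsPerturbation

end LandauFiber

end Perturbation

/-! ### Polynomials times Gaussians and their Fourier transforms -/

noncomputable section

section PolynomialGaussian

open Polynomial
open scoped FourierTransform SchwartzMap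

namespace LandauFiber

/-- The product of a polynomial and the Gaussian `exp (-c x²)`. -/
def polyGauss (c : ℝ) (P : ℝ[X]) (x : ℝ) : ℝ := P.eval x * Real.exp (-(c * x ^ 2))

theorem hasDerivAt_polyGauss (c : ℝ) (P : ℝ[X]) (x : ℝ) :
    HasDerivAt (polyGauss c P) (polyGauss c (derivative P - C (2 * c) * X * P) x) x := by
  have h := (P.hasDerivAt x).mul (((hasDerivAt_pow 2 x).const_mul c).neg.exp)
  refine h.congr_deriv ?_
  simp only [polyGauss, eval_sub, eval_mul, eval_C, eval_X, Pi.neg_apply]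
  push_cast
  ring

theorem iteratedDeriv_polyGauss (c : ℝ) (P : ℝ[X]) (n : ℕ) :
    ∃ Q : ℝ[X], iteratedDeriv n (polyGauss c P) = polyGauss c Q := by
  induction n with
  | zero => exact ⟨P, iteratedDeriv_zero⟩
  | succ n ih =>
    obtain ⟨Q, hQ⟩ := ih
    refine ⟨derivative Q - C (2 * c) * X * Q, ?_⟩
    rw [iteratedDeriv_succ, hQ]
    exact funext fun x => (hasDerivAt_polyGauss c Q x).deriv

theorem contDiff_polyGauss (c : ℝ) (P : ℝ[X]) {n : WithTop ℕ∞} : ContDiff ℝ n (polyGauss c P) := by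
  unfold polyGauss
  have : ContDiff ℝ n fun x => P.eval x := by
    simpa using! Polynomial.contDiff_aeval P n
  fun_prop

/-- For a monomial, `|x ^ n| ≤ 1 + x ^ (2n)`, and `exp (c x²)` dominates its `n`-th Taylor term. -/
theorem exists_abs_polyGauss_le {c : ℝ} (hc : 0 < c) (P : ℝ[X]) :
    ∃ M, ∀ x, |polyGauss c P x| ≤ M := by
  induction P using Polynomial.induction_on' with
  | add P Q hP hQ =>
    obtain ⟨M, hM⟩ := hP
    obtain ⟨N, hN⟩ := hQ
    refine ⟨M + N, fun x => ?_⟩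
    have : polyGauss c (P + Q) x = polyGauss c P x + polyGauss c Q x := by
      simp [polyGauss, add_mul]
    rw [this]
    exact (abs_add_le _ _).trans (add_le_add (hM x) (hN x))
  | monomial n a =>
    refine ⟨|a| * (1 + n.factorial / c ^ n), fun x => ?_⟩
    have h1 : |x ^ n| ≤ 1 + (x ^ 2) ^ n := by
      rw [abs_pow, ← sq_abs, ← pow_mul, mul_comm, pow_mul]
      nlinarith [sq_nonneg (|x| ^ n - 1)]
    have h2 : (c * x ^ 2) ^ n / n.factorial ≤ Real.exp (c * x ^ 2) :=
      Real.pow_div_factorial_le_exp _ (by positivity) n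
    have h3 : 1 ≤ Real.exp (c * x ^ 2) := Real.one_le_exp (by positivity)
    have h4 : (x ^ 2) ^ n ≤ n.factorial / c ^ n * Real.exp (c * x ^ 2) := by
      rw [mul_pow, div_le_iff₀ (by positivity)] at h2
      rw [div_mul_eq_mul_div, le_div_iff₀ (by positivity)]
      linarith
    simp only [polyGauss, eval_monomial, abs_mul, Real.abs_exp, mul_assoc]
    gcongr
    rw [Real.exp_neg, ← div_eq_mul_inv, div_le_iff₀ (Real.exp_pos _)]
    linarith

/-- `polyGauss` as a Schwartz function. -/
def polyGaussSchwartz {c : ℝ} (hc : 0 < c) (P : ℝ[X]) : 𝓢(ℝ, ℝ) where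
  toFun := polyGauss c P
  smooth' := contDiff_polyGauss c P
  decay' := fun k n => by
    obtain ⟨Q, hQ⟩ := iteratedDeriv_polyGauss c P n
    obtain ⟨M, hM⟩ := exists_abs_polyGauss_le hc (X ^ k * Q)
    refine ⟨M, fun x => ?_⟩
    rw [norm_iteratedFDeriv_eq_norm_iteratedDeriv, hQ]
    refine le_trans (le_of_eq ?_) (hM x)
    simp [polyGauss, abs_mul, mul_assoc]

@[simp]
theorem polyGaussSchwartz_apply {c : ℝ} (hc : 0 < c) (P : ℝ[X]) (x : ℝ) :
    polyGaussSchwartz hc P x = polyGauss c P x := rfl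

theorem integrable_polyGauss {c : ℝ} (hc : 0 < c) (P : ℝ[X]) : Integrable (polyGauss c P) :=
  (polyGaussSchwartz hc P).integrable

theorem memLp_polyGauss {c : ℝ} (hc : 0 < c) (P : ℝ[X]) : MemLp (polyGauss c P) 2 :=
  (polyGaussSchwartz hc P).memLp 2 volume

theorem polyGauss_mul_polyGauss (c d : ℝ) (P Q : ℝ[X]) (x : ℝ) :
    polyGauss c P x * polyGauss d Q x = polyGauss (c + d) (P * Q) x := by
  simp only [polyGauss, eval_mul]
  rw [show -((c + d) * x ^ 2) = -(c * x ^ 2) + -(d * x ^ 2) by ring, Real.exp_add]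
  ring

theorem fourier_add_of_integrable {f g : ℝ → ℂ} (hf : Integrable f) (hg : Integrable g) :
    𝓕 (f + g) = 𝓕 f + 𝓕 g :=
  VectorFourier.fourierIntegral_add Real.continuous_fourierChar continuous_inner hf hg

theorem fourier_const_smul_fun (r : ℂ) (f : ℝ → ℂ) : 𝓕 (r • f) = r • 𝓕 f :=
  VectorFourier.fourierIntegral_const_smul _ _ _ f r

/-- An integrable function with vanishing Fourier transform vanishes almost everywhere. -/
theorem ae_eq_zero_of_fourier_eq_zero {f : ℝ → ℂ} (hf : Integrable f) (h : 𝓕 f = 0) :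
    f =ᵐ[volume] 0 := by
  refine ae_eq_zero_of_integral_contDiff_smul_eq_zero hf.locallyIntegrable fun g hg hgc => ?_
  have hg' : ContDiff ℝ ∞ fun x => (g x : ℂ) := Complex.ofRealCLM.contDiff.comp hg
  have hgc' : HasCompactSupport fun x => (g x : ℂ) := hgc.comp_left Complex.ofReal_zero
  -- Writing the test function as a Fourier transform lets the pairing be moved onto the transform
  -- of `f`.
  let φ : 𝓢(ℝ, ℂ) := 𝓕⁻ (hgc'.toSchwartzMap hg')
  have hφ : ∀ x, 𝓕 (φ : ℝ → ℂ) x = (g x : ℂ) := fun x => by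
    rw [← SchwartzMap.fourier_coe]
    simp [φ]
  have key := VectorFourier.integral_fourierIntegral_smul_eq_flip (L := innerₗ ℝ)
      (μ := volume) (ν := volume)
      Real.continuous_fourierChar continuous_inner φ.integrable hf
  have e1 : ∀ ξ, VectorFourier.fourierIntegral Real.fourierChar volume (innerₗ ℝ) φ ξ = (g ξ : ℂ) :=
    fun ξ => hφ ξ
  have e2 : VectorFourier.fourierIntegral Real.fourierChar volume (innerₗ ℝ).flip f = 0 := by
    rw [flip_innerₗ]
    exact h
  simp only [e1, e2] at key
  simpa using key

/-- A square-integrable function, all of whose moments against a Gaussian vanish, is zero. -/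
theorem ae_eq_zero_of_integral_polyGauss_eq_zero {c : ℝ} (hc : 0 < c) {f : ℝ → ℂ}
    (hf : MemLp f 2) (h : ∀ n : ℕ, ∫ x, polyGauss c (X ^ n) x • f x = 0) : f =ᵐ[volume] 0 := by
  let F : ℝ → ℂ := fun x => Real.exp (-(c * x ^ 2)) • f x
  -- Completing the square gives `a |x| - c x² ≤ a² / (2c) - (c / 2) x²`.
  have hexp : ∀ a : ℝ, MemLp (fun x : ℝ => Real.exp (a * |x|) * Real.exp (-(c * x ^ 2))) 2 := by
    intro a
    have h1 := (memLp_polyGauss (half_pos hc) (C (Real.exp (a ^ 2 / (2 * c)))))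
    refine h1.mono (by fun_prop) (Filter.Eventually.of_forall fun x => ?_)
    simp only [polyGauss, eval_C]
    rw [← Real.exp_add, ← Real.exp_add, Real.norm_eq_abs, Real.norm_eq_abs, Real.abs_exp,
      Real.abs_exp]
    apply Real.exp_le_exp.2
    have : a ^ 2 / (2 * c) + -(c / 2 * x ^ 2) - (a * |x| + -(c * x ^ 2))
        = (a - c * |x|) ^ 2 / (2 * c) := by
      rw [← sq_abs x]
      field_simp
      ring
    have h2 : 0 ≤ (a - c * |x|) ^ 2 / (2 * c) := by positivity
    linarith
  have hint : ∀ a : ℝ, Integrable fun x : ℝ =>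
      (Real.exp (a * |x|) * Real.exp (-(c * x ^ 2))) * ‖f x‖ := fun a =>
    (hexp a).integrable_mul hf.norm
  have hFint : Integrable F := by
    have := (hexp 0).integrable_mul hf.norm
    refine this.mono' ?_ (Filter.Eventually.of_forall fun x => ?_)
    · exact (by fun_prop : Continuous fun x : ℝ =>
        Real.exp (-(c * x ^ 2))).aestronglyMeasurable.smul hf.1
    · simp only [F, norm_smul]
      simp [-Complex.ofReal_exp]
  have hF0 : F =ᵐ[volume] 0 := by
    refine ae_eq_zero_of_fourier_eq_zero hFint (funext fun ξ => ?_)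
    rw [Real.fourier_real_eq_integral_exp_smul]
    let z : ℂ := -2 * Real.pi * ξ * Complex.I
    have hz : ‖z‖ = 2 * Real.pi * |ξ| := by
      simp [z, abs_of_pos Real.pi_pos]
    -- Expand the Fourier character in its power series: each term integrates to a moment of `f`
    -- against the Gaussian, and `exp (‖z‖ |x|) ‖F x‖` dominates.
    have hsum := hasSum_integral_of_dominated_convergence (μ := volume)
      (F := fun (n : ℕ) (x : ℝ) => ((z * x) ^ n / n.factorial) • F x)
      (f := fun x : ℝ => Complex.exp (z * x) • F x)
      (fun n (x : ℝ) => ((‖z‖ * |x|) ^ n / n.factorial) * ‖F x‖)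
      (fun n => (by fun_prop : Continuous fun x : ℝ =>
        ((z * x) ^ n / n.factorial)).aestronglyMeasurable.smul hFint.1)
      (fun n => Filter.Eventually.of_forall fun x => by simp)
      (Filter.Eventually.of_forall fun x => (Real.summable_pow_div_factorial _).mul_right _)
      ((hint ‖z‖).congr (Filter.Eventually.of_forall fun x => by
        dsimp only
        rw [tsum_mul_right]
        rw [(NormedSpace.expSeries_div_hasSum_exp (‖z‖ * |x|)).tsum_eq, ← Real.exp_eq_exp_ℝ]
        simp only [F, norm_smul, Real.norm_eq_abs, Real.abs_exp, mul_assoc]))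
      (Filter.Eventually.of_forall fun x => by
        have := NormedSpace.expSeries_div_hasSum_exp (z * (x : ℂ))
        rw [← Complex.exp_eq_exp_ℂ] at this
        exact this.smul_const (F x))
    have hzero : ∀ n : ℕ, ∫ x : ℝ, ((z * (x : ℂ)) ^ n / n.factorial) • F x = 0 := fun n => by
      have e : ∀ x : ℝ, ((z * (x : ℂ)) ^ n / n.factorial) • F x
          = (z ^ n / n.factorial) • (polyGauss c (X ^ n) x • f x) := fun x => by
        simp only [F, polyGauss, eval_pow, eval_X, Complex.real_smul, smul_eq_mul]
        push_cast
        ring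
      simp_rw [e, integral_smul, h n, smul_zero]
    simp only [hzero] at hsum
    have := hsum.unique hasSum_zero
    rw [Pi.zero_apply, ← this]
    refine integral_congr_ae (Filter.Eventually.of_forall fun x => ?_)
    simp only [z]
    congr 2
    push_cast
    ring
  filter_upwards [hF0] with x hx
  simpa [F, Real.exp_ne_zero] using hx

/-- A factor `x` becomes a derivative in `ξ` up to a constant, which preserves the form polynomial
times Gaussian. -/
theorem fourier_polyGauss {c : ℝ} (hc : 0 < c) (P : ℝ[X]) :
    ∃ Q : ℂ[X], ∀ ξ : ℝ, 𝓕 (fun x => (polyGauss c P x : ℂ)) ξ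
      = Q.eval (ξ : ℂ) * Complex.exp (-(Real.pi ^ 2 / c) * ξ ^ 2) := by
  have hint : ∀ P : ℝ[X], Integrable fun x => (polyGauss c P x : ℂ) := fun P =>
    (integrable_polyGauss hc P).ofReal
  induction P using Polynomial.induction_on' with
  | add P P' hP hP' =>
    obtain ⟨Q, hQ⟩ := hP
    obtain ⟨Q', hQ'⟩ := hP'
    refine ⟨Q + Q', fun ξ => ?_⟩
    have e : (fun x => (polyGauss c (P + P') x : ℂ))
        = (fun x => (polyGauss c P x : ℂ)) + fun x => (polyGauss c P' x : ℂ) := by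
      ext x
      simp [polyGauss, add_mul]
    rw [e, fourier_add_of_integrable (hint P) (hint P'), Pi.add_apply, hQ, hQ', eval_add, add_mul]
  | monomial n a =>
    induction n with
    | zero =>
      refine ⟨C (a * (1 / ((c / Real.pi : ℝ) : ℂ) ^ (1 / 2 : ℂ))), fun ξ => ?_⟩
      have hpi : (Real.pi : ℂ) ≠ 0 := by exact_mod_cast Real.pi_ne_zero
      have hc' : (c : ℂ) ≠ 0 := by exact_mod_cast hc.ne'
      have h1 := fourier_gaussian_pi (b := ((c / Real.pi : ℝ) : ℂ))
        (by rw [Complex.ofReal_re]; exact div_pos hc Real.pi_pos)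
      have e : (fun x => (polyGauss c (monomial 0 a) x : ℂ))
          = (a : ℂ) • fun x : ℝ => Complex.exp (-Real.pi * ((c / Real.pi : ℝ) : ℂ) * x ^ 2) := by
        ext x
        simp only [polyGauss, eval_monomial, pow_zero, mul_one, Pi.smul_apply, smul_eq_mul]
        push_cast
        congr 2
        field_simp
      rw [e, fourier_const_smul_fun, Pi.smul_apply, h1, eval_C, smul_eq_mul, mul_assoc]
      congr 3
      push_cast
      field_simp
    | succ n ih =>
      obtain ⟨Q, hQ⟩ := ih
      let Q' : ℂ[X] := derivative Q - C (2 * (Real.pi ^ 2 / c : ℂ)) * X * Q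
      have hI : (-2 * Real.pi * Complex.I : ℂ) ≠ 0 := by
        simp [Real.pi_ne_zero, Complex.I_ne_zero]
      refine ⟨C (-2 * Real.pi * Complex.I)⁻¹ * Q', fun ξ => ?_⟩
      have e : ∀ x : ℝ, (polyGauss c (monomial (n + 1) a) x : ℂ)
          = x • (polyGauss c (monomial n a) x : ℂ) := fun x => by
        simp only [polyGauss, eval_monomial, Complex.real_smul]
        push_cast
        ring
      have hd := Real.hasDerivAt_fourier (hint (monomial n a))
        ((hint (monomial (n + 1) a)).congr (Filter.Eventually.of_forall e)) ξ
      have e2 : (fun x : ℝ => (-2 * Real.pi * Complex.I * x : ℂ) • (polyGauss c (monomial n a) x : ℂ))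
          = (-2 * Real.pi * Complex.I : ℂ) • fun x => (polyGauss c (monomial (n + 1) a) x : ℂ) := by
        ext x
        simp only [e, Pi.smul_apply, smul_eq_mul, Complex.real_smul]
        ring
      rw [e2, fourier_const_smul_fun, Pi.smul_apply] at hd
      have hd2 : HasDerivAt (𝓕 (fun x => (polyGauss c (monomial n a) x : ℂ)))
          (Q'.eval (ξ : ℂ) * Complex.exp (-(Real.pi ^ 2 / c) * ξ ^ 2)) ξ := by
        have h1 : HasDerivAt
            (fun w : ℂ => Q.eval w * Complex.exp (-(Real.pi ^ 2 / c) * w ^ 2))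
            (Q'.eval (ξ : ℂ) * Complex.exp (-(Real.pi ^ 2 / c) * ξ ^ 2)) (ξ : ℂ) := by
          refine ((Q.hasDerivAt _).mul
            (((hasDerivAt_pow 2 (ξ : ℂ)).const_mul (-(Real.pi ^ 2 / c : ℂ))).cexp)).congr_deriv ?_
          simp only [Q', eval_sub, eval_mul, eval_C, eval_X]
          push_cast
          ring
        exact h1.comp_ofReal.congr_of_eventuallyEq (Filter.Eventually.of_forall hQ)
      have := hd.unique hd2
      rw [eval_mul, eval_C, mul_assoc, ← this, smul_eq_mul, inv_mul_cancel_left₀ hI]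

/-- Only the zeros of the polynomial factor matter; that factor is nonzero by injectivity of the
Fourier transform. -/
theorem ae_fourier_polyGauss_ne_zero {c : ℝ} (hc : 0 < c) {P : ℝ[X]} (hP : P ≠ 0) :
    ∀ᵐ ξ : ℝ, 𝓕 (fun x => (polyGauss c P x : ℂ)) ξ ≠ 0 := by
  obtain ⟨Q, hQ⟩ := fourier_polyGauss hc P
  have hQ0 : Q ≠ 0 := by
    rintro rfl
    have h0 := ae_eq_zero_of_fourier_eq_zero (integrable_polyGauss hc P).ofReal
      (funext fun ξ => by simpa using hQ ξ)
    have h1 := Continuous.ae_eq_iff_eq volume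
      (Complex.continuous_ofReal.comp (contDiff_polyGauss c P (n := 0)).continuous)
      continuous_zero |>.1 h0
    apply hP
    refine Polynomial.funext fun x => ?_
    have := congrFun h1 x
    simpa [polyGauss, Real.exp_ne_zero] using this
  have hfin : {ξ : ℝ | Q.eval (ξ : ℂ) = 0}.Finite := by
    have : (Q.rootSet ℂ).Finite := Q.rootSet_finite ℂ
    refine (this.preimage (f := ((↑) : ℝ → ℂ)) Complex.ofReal_injective.injOn).subset ?_
    intro ξ hξ
    simp only [Set.mem_preimage, mem_rootSet]
    exact ⟨hQ0, by simpa using hξ⟩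
  have hnull := hfin.measure_zero (volume : Measure ℝ)
  filter_upwards [compl_mem_ae_iff.2 hnull] with ξ hξ
  rw [hQ]
  exact mul_ne_zero hξ (Complex.exp_ne_zero _)

end LandauFiber

end PolynomialGaussian

end

/-! ### Eigenfunctions of the harmonic oscillator -/

noncomputable section

section LandauFunctions

open Polynomial

namespace LandauFiber

theorem integrable_smul_of_memLp_two {f : ℝ → ℝ} {g : ℝ → ℂ} (hf : MemLp f 2) (hg : MemLp g 2) :
    Integrable fun x => f x • g x := by
  have : Integrable ((fun x => (f x : ℂ)) * g) := MemLp.integrable_mul hf.ofReal hg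
  exact this.congr (Filter.Eventually.of_forall fun x => by simp)

/-- The Hermite polynomials rescaled so that `hermitePoly B k * exp (-B x² / 2)` is the `k`-th
eigenfunction of `-∂² + B² x²`. -/
def hermitePoly (B : ℝ) : ℕ → ℝ[X]
  | 0 => 1
  | k + 1 => C (2 * B) * X * hermitePoly B k - derivative (hermitePoly B k)

/-- The two identities are proved together: the first at `k` gives the second at `k + 1`, which
gives the first at `k + 1`. -/
theorem hermitePoly_ode (B : ℝ) (k : ℕ) :
    derivative (hermitePoly B (k + 1)) = C (2 * B * (k + 1)) * hermitePoly B k ∧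
      C (2 * B) * X * derivative (hermitePoly B k) - derivative (derivative (hermitePoly B k))
        = C (2 * B * k) * hermitePoly B k := by
  induction k with
  | zero => simp [hermitePoly]
  | succ k ih =>
    obtain ⟨h1, h2⟩ := ih
    have h3 : C (2 * B) * X * derivative (hermitePoly B (k + 1))
        - derivative (derivative (hermitePoly B (k + 1)))
        = C (2 * B * (k + 1 : ℕ)) * hermitePoly B (k + 1) := by
      rw [h1, derivative_mul, derivative_C, zero_mul, zero_add, hermitePoly]
      push_cast
      ring
    refine ⟨?_, h3⟩
    rw [hermitePoly, derivative_sub, derivative_mul, derivative_mul, derivative_C, derivative_X]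
    have : C (2 * B * ((k + 1 : ℕ) + 1 : ℝ)) = C (2 * B) + C (2 * B * (k + 1 : ℕ)) := by
      rw [← C_add]
      congr 1
      ring
    rw [this]
    linear_combination h3

theorem degree_hermitePoly {B : ℝ} (hB : 0 < B) (k : ℕ) : (hermitePoly B k).degree = k := by
  induction k with
  | zero => simp [hermitePoly]
  | succ k ih =>
    have h0 : hermitePoly B k ≠ 0 := fun h => by rw [h, degree_zero] at ih; simp at ih
    have h1 : (C (2 * B) * X * hermitePoly B k).degree = ((k + 1 : ℕ) : WithBot ℕ) := by
      rw [degree_mul, degree_C_mul_X (by positivity), ih]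
      push_cast
      ring
    rw [hermitePoly, degree_sub_eq_left_of_degree_lt, h1]
    rw [h1]
    refine (degree_derivative_lt h0).trans ?_
    rw [ih]
    exact_mod_cast k.lt_succ_self

theorem hermitePoly_ne_zero {B : ℝ} (hB : 0 < B) (k : ℕ) : hermitePoly B k ≠ 0 := fun h => by
  have := degree_hermitePoly hB k
  rw [h, degree_zero] at this
  simp at this

theorem span_hermitePoly {B : ℝ} (hB : 0 < B) :
    Submodule.span ℝ (Set.range (hermitePoly B)) = ⊤ :=
  Polynomial.Sequence.span ⟨hermitePoly B, degree_hermitePoly hB⟩ fun k =>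
    isUnit_iff_ne_zero.2 (leadingCoeff_ne_zero.2 (hermitePoly_ne_zero hB k))

/-- The polynomial factor of the `k`-th normalized eigenfunction of `-∂² + B² x²`. -/
def landauPoly (B : ℝ) (k : ℕ) : ℝ[X] :=
  C (√(∫ x, polyGauss (B / 2) (hermitePoly B k) x ^ 2))⁻¹ * hermitePoly B k

/-- The `k`-th normalized eigenfunction of `-∂² + B² x²`. -/
def landauFun (B : ℝ) (k : ℕ) (x : ℝ) : ℝ := polyGauss (B / 2) (landauPoly B k) x

/-- The derivative of `landauFun`. -/
def landauFunDeriv (B : ℝ) (k : ℕ) (x : ℝ) : ℝ :=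
  polyGauss (B / 2) (derivative (landauPoly B k) - C B * X * landauPoly B k) x

theorem hasDerivAt_landauFun (B : ℝ) (k : ℕ) (x : ℝ) :
    HasDerivAt (landauFun B k) (landauFunDeriv B k x) x := by
  have := hasDerivAt_polyGauss (B / 2) (landauPoly B k) x
  rwa [mul_div_cancel₀ B two_ne_zero] at this

theorem landauPoly_ode (B : ℝ) (k : ℕ) :
    C (2 * B) * X * derivative (landauPoly B k) - derivative (derivative (landauPoly B k))
        = C (2 * B * k) * landauPoly B k := by
  have := (hermitePoly_ode B k).2
  simp only [landauPoly, derivative_mul, derivative_C, zero_mul, zero_add]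
  linear_combination (C (√(∫ x, polyGauss (B / 2) (hermitePoly B k) x ^ 2))⁻¹) * this

theorem landauFunDeriv_poly (B : ℝ) (k : ℕ) :
    derivative (derivative (landauPoly B k) - C B * X * landauPoly B k)
      - C B * X * (derivative (landauPoly B k) - C B * X * landauPoly B k)
      = (C (B ^ 2) * X ^ 2 - C (level B k)) * landauPoly B k := by
  have h := landauPoly_ode B k
  have e : C (level B k) = C (2 * B * k) + C B := by
    rw [← C_add, level]
    congr 1
    ring
  have e2 : C (B ^ 2) = C B * (C B : ℝ[X]) := by rw [← C_mul, sq]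
  have e3 : C (2 * B) = C B + (C B : ℝ[X]) := by rw [← C_add, two_mul]
  rw [e3] at h
  rw [e, e2]
  simp only [derivative_sub, derivative_mul, derivative_C, derivative_X]
  linear_combination -h

theorem landauFun_second_deriv_eq (B : ℝ) (k : ℕ) (x : ℝ) :
    polyGauss (B / 2) ((C (B ^ 2) * X ^ 2 - C (level B k)) * landauPoly B k) x
      = ((B * x) ^ 2 - level B k) * landauFun B k x := by
  simp only [polyGauss, landauFun, eval_mul, eval_sub, eval_C, eval_pow, eval_X]
  ring

theorem hasDerivAt_landauFunDeriv (B : ℝ) (k : ℕ) (x : ℝ) :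
    HasDerivAt (landauFunDeriv B k) (((B * x) ^ 2 - level B k) * landauFun B k x) x := by
  have := hasDerivAt_polyGauss (B / 2) (derivative (landauPoly B k) - C B * X * landauPoly B k) x
  rwa [mul_div_cancel₀ B two_ne_zero, landauFunDeriv_poly, landauFun_second_deriv_eq] at this

theorem contDiff_landauFun (B : ℝ) (k : ℕ) {n : WithTop ℕ∞} : ContDiff ℝ n (landauFun B k) :=
  contDiff_polyGauss _ _

theorem continuous_landauFun (B : ℝ) (k : ℕ) : Continuous (landauFun B k) :=
  (contDiff_landauFun B k (n := 0)).continuous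

theorem continuous_landauFunDeriv (B : ℝ) (k : ℕ) : Continuous (landauFunDeriv B k) :=
  (contDiff_polyGauss (n := 0) _ _).continuous

theorem memLp_landauFun {B : ℝ} (hB : 0 < B) (k : ℕ) : MemLp (landauFun B k) 2 :=
  memLp_polyGauss (half_pos hB) _

theorem memLp_landauFunDeriv {B : ℝ} (hB : 0 < B) (k : ℕ) : MemLp (landauFunDeriv B k) 2 :=
  memLp_polyGauss (half_pos hB) _

theorem memLp_landauFun_second_deriv {B : ℝ} (hB : 0 < B) (k : ℕ) :
    MemLp (fun x => ((B * x) ^ 2 - level B k) * landauFun B k x) 2 := by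
  simp_rw [← landauFun_second_deriv_eq]
  exact memLp_polyGauss (half_pos hB) _

theorem integral_landauFun_sq {B : ℝ} (hB : 0 < B) (k : ℕ) : ∫ x, landauFun B k x ^ 2 = 1 := by
  set c := ∫ x, polyGauss (B / 2) (hermitePoly B k) x ^ 2 with hc
  have hcpos : 0 < c := by
    have hcont : Continuous fun x => polyGauss (B / 2) (hermitePoly B k) x ^ 2 :=
      ((contDiff_polyGauss (n := 0) _ _).continuous).pow 2
    obtain ⟨x, hx⟩ : ∃ x, (hermitePoly B k).eval x ≠ 0 := by
      by_contra! h
      exact hermitePoly_ne_zero hB k (Polynomial.funext fun x => by simpa using h x)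
    refine integral_pos_of_integrable_nonneg_nonzero hcont
      (memLp_polyGauss (half_pos hB) _).integrable_sq (fun _ => sq_nonneg _) (x := x) ?_
    exact pow_ne_zero 2 (mul_ne_zero hx (Real.exp_ne_zero _))
  have e : ∀ x, landauFun B k x ^ 2 = c⁻¹ * polyGauss (B / 2) (hermitePoly B k) x ^ 2 := fun x => by
    rw [landauFun, landauPoly, ← hc]
    simp only [polyGauss, eval_mul, eval_C]
    rw [mul_assoc, mul_pow, inv_pow, Real.sq_sqrt hcpos.le]
  simp_rw [e]
  rw [integral_const_mul, ← hc, inv_mul_cancel₀ hcpos.ne']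

/-- The Wronskian of the two functions has derivative `(level B j - level B k)` times their product,
and its derivative integrates to zero. -/
theorem integral_landauFun_mul {B : ℝ} (hB : 0 < B) {j k : ℕ} (hjk : j ≠ k) :
    ∫ x, landauFun B j x * landauFun B k x = 0 := by
  have hd : ∀ x, HasDerivAt
      (fun x => landauFun B j x * landauFunDeriv B k x - landauFunDeriv B j x * landauFun B k x)
      ((level B j - level B k) * (landauFun B j x * landauFun B k x)) x := fun x => by
    refine (((hasDerivAt_landauFun B j x).mul (hasDerivAt_landauFunDeriv B k x)).sub
      ((hasDerivAt_landauFunDeriv B j x).mul (hasDerivAt_landauFun B k x))).congr_deriv ?_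
    ring
  have h0 := integral_eq_zero_of_hasDerivAt_of_integrable hd
    (((memLp_landauFun hB j).integrable_mul (memLp_landauFun hB k)).const_mul _)
    (((memLp_landauFun hB j).integrable_mul (memLp_landauFunDeriv hB k)).sub
      ((memLp_landauFunDeriv hB j).integrable_mul (memLp_landauFun hB k)))
  rw [integral_const_mul] at h0
  refine (mul_eq_zero.1 h0).resolve_left fun h => hjk ?_
  unfold level at h
  have h' : 2 * B * ((j : ℝ) - k) = 0 := by linarith
  have := (mul_eq_zero.1 h').resolve_left (by positivity)
  exact_mod_cast sub_eq_zero.1 this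

/-- Kinetic energy is at most total energy, since `(B x)²` is nonnegative. -/
theorem integral_landauFunDeriv_sq_le {B : ℝ} (hB : 0 < B) (k : ℕ) :
    ∫ x, landauFunDeriv B k x ^ 2 ≤ level B k := by
  have i1 := (memLp_landauFunDeriv hB k).integrable_sq
  have i2 : Integrable fun x =>
      landauFun B k x * (((B * x) ^ 2 - level B k) * landauFun B k x) :=
    (memLp_landauFun hB k).integrable_mul (memLp_landauFun_second_deriv hB k)
  have i3 := (memLp_landauFun hB k).integrable_sq
  have hd : ∀ x, HasDerivAt (fun x => landauFun B k x * landauFunDeriv B k x)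
      (landauFunDeriv B k x ^ 2 + landauFun B k x * (((B * x) ^ 2 - level B k) * landauFun B k x))
      x := fun x => by
    refine ((hasDerivAt_landauFun B k x).mul (hasDerivAt_landauFunDeriv B k x)).congr_deriv ?_
    ring
  have h0 := integral_eq_zero_of_hasDerivAt_of_integrable hd (i1.add i2)
    ((memLp_landauFun hB k).integrable_mul (memLp_landauFunDeriv hB k))
  rw [integral_add i1 i2] at h0
  have h1 : -(level B k * ∫ x, landauFun B k x ^ 2)
      ≤ ∫ x, landauFun B k x * (((B * x) ^ 2 - level B k) * landauFun B k x) := by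
    rw [← integral_const_mul, ← integral_neg]
    refine integral_mono (i3.const_mul _).neg i2 fun x => ?_
    have : 0 ≤ (B * x) ^ 2 * landauFun B k x ^ 2 := by positivity
    dsimp only
    linarith
  rw [integral_landauFun_sq hB] at h1
  linarith

/-- Write the square as the integral of `2 φ φ'` up to `x` and use `2 |φ φ'| ≤ s φ² + s⁻¹ φ'²` with
`s = √(level B k)`. Growth no faster than this square root is what makes `levelSum` converge. -/
theorem landauFun_sq_le {B : ℝ} (hB : 0 < B) (k : ℕ) (x : ℝ) :
    landauFun B k x ^ 2 ≤ 2 * √(level B k) := by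
  have hμ := level_pos hB k
  set s := √(level B k) with hs
  have hs0 : 0 < s := Real.sqrt_pos.2 hμ
  have hss : s * s = level B k := Real.mul_self_sqrt hμ.le
  have hd : ∀ y, HasDerivAt (fun y => landauFun B k y ^ 2)
      (2 * (landauFun B k y * landauFunDeriv B k y)) y := fun y => by
    refine ((hasDerivAt_landauFun B k y).pow 2).congr_deriv ?_
    push_cast
    ring
  have i1 := (memLp_landauFun hB k).integrable_sq
  have i2 := (memLp_landauFunDeriv hB k).integrable_sq
  have i3 : Integrable fun y => 2 * (landauFun B k y * landauFunDeriv B k y) :=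
    ((memLp_landauFun hB k).integrable_mul (memLp_landauFunDeriv hB k)).const_mul 2
  have ht := tendsto_zero_of_hasDerivAt_of_integrableOn_Iic (a := x) (fun y _ => hd y)
    i3.integrableOn i1.integrableOn
  have h1 := integral_Iic_of_hasDerivAt_of_tendsto' (a := x) (fun y _ => hd y) i3.integrableOn ht
  rw [sub_zero] at h1
  have i4 : Integrable fun y => s * landauFun B k y ^ 2 + s⁻¹ * landauFunDeriv B k y ^ 2 :=
    (i1.const_mul _).add (i2.const_mul _)
  have hle : ∀ y, ‖2 * (landauFun B k y * landauFunDeriv B k y)‖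
      ≤ s * landauFun B k y ^ 2 + s⁻¹ * landauFunDeriv B k y ^ 2 := fun y => by
    rw [Real.norm_eq_abs, abs_le]
    have e1 : s * landauFun B k y ^ 2 + s⁻¹ * landauFunDeriv B k y ^ 2
        - 2 * (landauFun B k y * landauFunDeriv B k y)
        = s⁻¹ * (s * landauFun B k y - landauFunDeriv B k y) ^ 2 := by field_simp; ring
    have e2 : s * landauFun B k y ^ 2 + s⁻¹ * landauFunDeriv B k y ^ 2
        + 2 * (landauFun B k y * landauFunDeriv B k y)
        = s⁻¹ * (s * landauFun B k y + landauFunDeriv B k y) ^ 2 := by field_simp; ring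
    have p1 : 0 ≤ s⁻¹ * (s * landauFun B k y - landauFunDeriv B k y) ^ 2 := by positivity
    have p2 : 0 ≤ s⁻¹ * (s * landauFun B k y + landauFunDeriv B k y) ^ 2 := by positivity
    constructor <;> linarith
  rw [← h1]
  calc _ ≤ ∫ y in Set.Iic x, ‖2 * (landauFun B k y * landauFunDeriv B k y)‖ :=
        (Real.le_norm_self _).trans (norm_integral_le_integral_norm _)
    _ ≤ ∫ y, ‖2 * (landauFun B k y * landauFunDeriv B k y)‖ :=
        setIntegral_le_integral i3.norm (Filter.Eventually.of_forall fun _ => norm_nonneg _)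
    _ ≤ ∫ y, s * landauFun B k y ^ 2 + s⁻¹ * landauFunDeriv B k y ^ 2 :=
        integral_mono i3.norm i4 hle
    _ = s * 1 + s⁻¹ * ∫ y, landauFunDeriv B k y ^ 2 := by
        rw [integral_add (i1.const_mul _) (i2.const_mul _), integral_const_mul, integral_const_mul,
          integral_landauFun_sq hB]
    _ ≤ s * 1 + s⁻¹ * (s * s) := by
        rw [hss]
        gcongr
        exact integral_landauFunDeriv_sq_le hB k
    _ = 2 * s := by field_simp; ring

/-- The polynomial factors span all polynomials, so every Gaussian moment vanishes. This is
completeness of the eigenfunctions. -/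
theorem ae_eq_zero_of_integral_landauFun_eq_zero {B : ℝ} (hB : 0 < B) {f : ℝ → ℂ}
    (hf : MemLp f 2) (h : ∀ k, ∫ x, landauFun B k x • f x = 0) : f =ᵐ[volume] 0 := by
  refine ae_eq_zero_of_integral_polyGauss_eq_zero (half_pos hB) hf fun n => ?_
  have hint : ∀ P : ℝ[X], Integrable fun x => polyGauss (B / 2) P x • f x := fun P =>
    integrable_smul_of_memLp_two (memLp_polyGauss (half_pos hB) P) hf
  let Λ : ℝ[X] →ₗ[ℝ] ℂ :=
    { toFun := fun P => ∫ x, polyGauss (B / 2) P x • f x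
      map_add' := fun P Q => by
        rw [← integral_add (hint P) (hint Q)]
        exact integral_congr_ae (Filter.Eventually.of_forall fun x => by
          simp [polyGauss, add_mul])
      map_smul' := fun c P => by
        rw [RingHom.id_apply, ← integral_smul]
        exact integral_congr_ae (Filter.Eventually.of_forall fun x => by
          simp only [polyGauss, eval_smul, smul_eq_mul, Complex.real_smul]
          push_cast
          ring) }
  have hΛ : Λ = 0 := by
    refine LinearMap.ext_on_range (span_hermitePoly hB) fun k => ?_
    have h1 : Λ (landauPoly B k) = 0 := h k
    have h2 : landauPoly B k = (√(∫ x, polyGauss (B / 2) (hermitePoly B k) x ^ 2))⁻¹ •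
        hermitePoly B k := by rw [landauPoly, smul_eq_C_mul]
    rw [h2, map_smul, smul_eq_zero] at h1
    refine h1.resolve_left fun h3 => ?_
    have h4 := integral_landauFun_sq hB k
    simp only [landauFun, landauPoly, h3] at h4
    simp [polyGauss] at h4
  exact LinearMap.congr_fun hΛ (X ^ n)

end LandauFiber

end LandauFunctions

end

/-! ### Nonconstancy of the first order coefficient -/

noncomputable section

section Nonconstancy

open Polynomial
open scoped FourierTransform SchwartzMap

namespace LandauFiber

/-- The correlation of a nonzero square-integrable function with a polynomial times a Gaussian
is not constant. -/
theorem exists_integral_mul_polyGauss_ne {v : ℝ → ℝ} (hv : MemLp v 2) (hv0 : ¬ v =ᵐ[volume] 0)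
    {c : ℝ} (hc : 0 < c) {P : ℝ[X]} (hP : P ≠ 0) :
    ∃ s t, ∫ x, v x * polyGauss c P (x + s) ≠ ∫ x, v x * polyGauss c P (x + t) := by
  by_contra! hconst
  apply hv0
  have hvC : MemLp (fun x => (v x : ℂ)) 2 := hv.ofReal
  let V : L2 := hvC.toLp
  let g : 𝓢(ℝ, ℂ) := (polyGaussSchwartz hc P).postcompCLM Complex.ofRealCLM
  -- `F` is a product of two square-integrable functions, hence integrable; by Plancherel its
  -- Fourier transform at `s` is the correlation at shift `s`.
  let F : ℝ → ℂ := fun ξ => (starRingEnd ℂ) (𝓕 g ξ) * (𝓕 V : L2) ξ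
  have hF : Integrable F := by
    have h1 : MemLp (fun ξ => (starRingEnd ℂ) (𝓕 g ξ)) 2 :=
      ((𝓕 g).memLp 2 volume).star
    exact h1.integrable_mul (Lp.memLp _)
  have hs : ∀ s : ℝ, 𝓕 F s = ((∫ x, v x * polyGauss c P (x + s) : ℝ) : ℂ) := fun s => by
    let gs : 𝓢(ℝ, ℂ) := g.compSubConstCLM ℂ (-s)
    have h1 : inner ℂ (gs.toLp 2) V = ((∫ x, v x * polyGauss c P (x + s) : ℝ) : ℂ) := by
      rw [L2.inner_def, ← integral_complex_ofReal]
      apply integral_congr_ae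
      filter_upwards [gs.coeFn_toLp 2 volume, hvC.coeFn_toLp] with x hx hx'
      rw [hx, hx']
      simp [gs, g]
    have h2 : inner ℂ (gs.toLp 2) V = 𝓕 F s := by
      rw [← Lp.inner_fourier_eq, SchwartzMap.toLp_fourier_eq, L2.inner_def, Real.fourier_real_eq]
      apply integral_congr_ae
      filter_upwards [(𝓕 gs).coeFn_toLp 2 volume] with ξ hξ
      have h3 : 𝓕 gs ξ = Real.fourierChar (s * ξ) • 𝓕 g ξ := by
        rw [SchwartzMap.fourier_coe, SchwartzMap.fourier_coe]
        have e : (gs : ℝ → ℂ) = (g : ℝ → ℂ) ∘ fun x => x + s := by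
          ext x
          simp [gs]
        rw [e]
        have := VectorFourier.fourierIntegral_comp_add_right Real.fourierChar volume
          (innerₗ ℝ) (g : ℝ → ℂ) s
        have h4 := congrFun this ξ
        simpa [mul_comm] using! h4
      rw [hξ, h3]
      simp only [F, RCLike.inner_apply, Circle.smul_def, smul_eq_mul, map_mul]
      have h5 : (starRingEnd ℂ) (Real.fourierChar (s * ξ) : ℂ) = Real.fourierChar (-(ξ * s)) := by
        rw [mul_comm s ξ, AddChar.map_neg_eq_inv, Circle.coe_inv_eq_conj]
      rw [h5]
      ring
    rw [← h2, h1]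
  -- By Riemann–Lebesgue a constant Fourier transform of an integrable function must be zero.
  have h0 : 𝓕 F = 0 := by
    have hlim := Real.zero_at_infty_fourier F
    have he : 𝓕 F = fun _ => 𝓕 F 0 := funext fun s => by rw [hs, hs, hconst s 0]
    rw [he] at hlim ⊢
    have := tendsto_nhds_unique hlim tendsto_const_nhds
    rw [← this]
    rfl
  have hV0 : 𝓕 V = 0 := by
    apply Lp.eq_zero_iff_ae_eq_zero.2
    filter_upwards [ae_eq_zero_of_fourier_eq_zero hF h0, ae_fourier_polyGauss_ne_zero hc hP]
      with ξ h1 h2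
    have h3 : 𝓕 g ξ ≠ 0 := h2
    simpa [F, h3] using h1
  have hV : V = 0 := by
    rw [← norm_eq_zero, ← Lp.norm_fourier_eq, hV0, norm_zero]
  have := Lp.eq_zero_iff_ae_eq_zero.1 hV
  filter_upwards [this, hvC.coeFn_toLp] with x h1 h2
  have : ((v x : ℝ) : ℂ) = 0 := h2.symm.trans h1
  simpa using this

theorem exists_integral_mul_landauFun_sq_ne {v : ℝ → ℝ} (hv : MemLp v 2)
    (hv0 : ¬ v =ᵐ[volume] 0) {B : ℝ} (hB : 0 < B) (k : ℕ) :
    ∃ s t, ∫ x, v x * landauFun B k (x + s) ^ 2 ≠ ∫ x, v x * landauFun B k (x + t) ^ 2 := by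
  have hP : landauPoly B k * landauPoly B k ≠ 0 := mul_self_ne_zero.2 fun h => by
    have := integral_landauFun_sq hB k
    simp [landauFun, h, polyGauss] at this
  have e : ∀ x, landauFun B k x ^ 2
      = polyGauss (B / 2 + B / 2) (landauPoly B k * landauPoly B k) x := fun x => by
    rw [← polyGauss_mul_polyGauss, sq, landauFun]
  simp_rw [e]
  exact exists_integral_mul_polyGauss_ne hv hv0 (by positivity) hP

end LandauFiber

end Nonconstancy

end

/-! ### The translated eigenbasis and multiplication by the potential -/

noncomputable section

section LandauBasis

open scoped InnerProductSpace

namespace LandauFiber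

/-- A real square-integrable function as an element of the complex Hilbert space `L2`. -/
def toL2 (f : ℝ → ℝ) (hf : MemLp f 2) : L2 :=
  MemLp.toLp (fun x => (f x : ℂ)) hf.ofReal

theorem coeFn_toL2 {f : ℝ → ℝ} (hf : MemLp f 2) : toL2 f hf =ᵐ[volume] fun x => (f x : ℂ) :=
  MemLp.coeFn_toLp _

theorem inner_toL2 {f : ℝ → ℝ} (hf : MemLp f 2) (ψ : L2) : ⟪toL2 f hf, ψ⟫_ℂ = ∫ x, f x • ψ x := by
  rw [MeasureTheory.L2.inner_def]
  apply integral_congr_ae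
  filter_upwards [coeFn_toL2 hf] with x hx
  simp [hx, mul_comm]

theorem inner_toL2_toL2 {f g : ℝ → ℝ} (hf : MemLp f 2) (hg : MemLp g 2) :
    ⟪toL2 f hf, toL2 g hg⟫_ℂ = ((∫ x, f x * g x : ℝ) : ℂ) := by
  rw [inner_toL2, ← integral_complex_ofReal]
  apply integral_congr_ae
  filter_upwards [coeFn_toL2 hg] with x hx
  simp [hx]

theorem norm_toL2_sq {f : ℝ → ℝ} (hf : MemLp f 2) : ‖toL2 f hf‖ ^ 2 = ∫ x, f x ^ 2 := by
  rw [← inner_self_eq_norm_sq (𝕜 := ℂ), inner_toL2_toL2 hf hf]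
  simp [sq]

theorem memLp_mul_of_bounded {f g : ℝ → ℝ} (hf : MemLp f 2) (hg : Continuous g) {C : ℝ}
    (hC : ∀ x, |g x| ≤ C) : MemLp (fun x => f x * g x) 2 := by
  refine (hf.const_mul C).mono (hf.1.mul hg.aestronglyMeasurable)
    (Filter.Eventually.of_forall fun x => ?_)
  have hC0 : 0 ≤ C := (abs_nonneg _).trans (hC x)
  rw [norm_mul, norm_mul, mul_comm, Real.norm_eq_abs (g x), Real.norm_eq_abs C, abs_of_nonneg hC0]
  gcongr
  exact hC x

theorem memLp_comp_add_right {E : Type*} [NormedAddCommGroup E] {f : ℝ → E} (hf : MemLp f 2)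
    (a : ℝ) : MemLp (fun x => f (x + a)) 2 :=
  hf.comp_measurePreserving (measurePreserving_add_right volume a)

theorem memLp_landauFun_add {B : ℝ} (hB : 0 < B) (a : ℝ) (k : ℕ) :
    MemLp (fun x => landauFun B k (x + a)) 2 :=
  memLp_comp_add_right (memLp_landauFun hB k) a

theorem orthonormal_landauFun {B : ℝ} (hB : 0 < B) (a : ℝ) :
    Orthonormal ℂ fun k => toL2 _ (memLp_landauFun_add hB a k) := by
  rw [orthonormal_iff_ite]
  intro j k
  rw [inner_toL2_toL2, integral_add_right_eq_self (fun x => landauFun B j x * landauFun B k x)]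
  split_ifs with hjk
  · rw [hjk]
    have := integral_landauFun_sq hB k
    simp_rw [sq] at this
    simp [this]
  · rw [integral_landauFun_mul hB hjk, Complex.ofReal_zero]

theorem orthogonal_span_landauFun {B : ℝ} (hB : 0 < B) (a : ℝ) :
    (Submodule.span ℂ (Set.range fun k => toL2 _ (memLp_landauFun_add hB a k)))ᗮ = ⊥ := by
  rw [Submodule.eq_bot_iff]
  intro ψ hψ
  have h0 : (fun x => ψ (x - a)) =ᵐ[volume] 0 := by
    refine ae_eq_zero_of_integral_landauFun_eq_zero hB
      (by simpa [sub_eq_add_neg] using memLp_comp_add_right (Lp.memLp ψ) (-a)) fun k => ?_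
    have h1 := (Submodule.mem_orthogonal _ _).1 hψ _ (Submodule.subset_span ⟨k, rfl⟩)
    rw [inner_toL2] at h1
    rw [← integral_add_right_eq_self (fun x => landauFun B k x • ψ (x - a)) a]
    simpa using h1
  apply Lp.eq_zero_iff_ae_eq_zero.2
  have h2 := (measurePreserving_add_right volume a).quasiMeasurePreserving.ae h0
  filter_upwards [h2] with x hx
  simpa using hx

/-- The Hilbert basis of eigenfunctions of `-∂² + B² (x + a)²`. -/
def landauBasis {B : ℝ} (hB : 0 < B) (a : ℝ) : HilbertBasis ℕ ℂ L2 :=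
  HilbertBasis.mkOfOrthogonalEqBot (orthonormal_landauFun hB a) (orthogonal_span_landauFun hB a)

theorem landauBasis_apply {B : ℝ} (hB : 0 < B) (a : ℝ) (k : ℕ) :
    landauBasis hB a k = toL2 _ (memLp_landauFun_add hB a k) := by
  rw [landauBasis, HilbertBasis.coe_mkOfOrthogonalEqBot]

theorem abs_landauFun_le {B : ℝ} (hB : 0 < B) (k : ℕ) (x : ℝ) :
    |landauFun B k x| ≤ √(2 * √(level B k)) :=
  Real.abs_le_sqrt (landauFun_sq_le hB k x)

/-- Multiplication of the basis functions by a square-integrable potential. -/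
theorem memLp_mul_landauFun {B : ℝ} (hB : 0 < B) (a : ℝ) {w : ℝ → ℝ} (hw : MemLp w 2) (k : ℕ) :
    MemLp (fun x => w x * landauFun B k (x + a)) 2 :=
  memLp_mul_of_bounded hw ((continuous_landauFun B k).comp (continuous_id.add continuous_const))
    fun x => abs_landauFun_le hB k (x + a)

theorem norm_mul_landauFun_sq_le {B : ℝ} (hB : 0 < B) (a : ℝ) {w : ℝ → ℝ} (hw : MemLp w 2)
    (k : ℕ) : ‖toL2 _ (memLp_mul_landauFun hB a hw k)‖ ^ 2 ≤ 2 * √(level B k) * ∫ x, w x ^ 2 := by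
  rw [norm_toL2_sq, ← integral_const_mul]
  refine integral_mono (memLp_mul_landauFun hB a hw k).integrable_sq
    (hw.integrable_sq.const_mul _) fun x => ?_
  dsimp only
  rw [mul_pow, mul_comm]
  gcongr
  exact landauFun_sq_le hB k _

/-- The squared norm of the unperturbed resolvent from `L²` to `L^∞` is bounded by this sum. -/
def levelSum (B : ℝ) : ℝ := ∑' k, (level B k)⁻¹ ^ 2 * (2 * √(level B k))

/-- The terms are `2 (level B k) ^ (-3/2)`, comparable to a convergent `p`-series. -/
theorem summable_level {B : ℝ} (hB : 0 < B) :
    Summable fun k => (level B k)⁻¹ ^ 2 * (2 * √(level B k)) := by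
  have h1 : Summable fun k : ℕ => ((k + 1 : ℕ) : ℝ) ^ (-(3 / 2) : ℝ) :=
    (summable_nat_add_iff 1).2 (Real.summable_nat_rpow.2 (by norm_num))
  refine .of_nonneg_of_le (fun k => by positivity) (fun k => ?_)
    (h1.mul_left (2 * B ^ (-(3 / 2) : ℝ)))
  have hμ := level_pos hB k
  have e : (level B k)⁻¹ ^ 2 * (2 * √(level B k)) = 2 * level B k ^ (-(3 / 2) : ℝ) := by
    rw [Real.sqrt_eq_rpow, ← Real.rpow_neg_one, ← Real.rpow_natCast, ← Real.rpow_mul hμ.le,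
      mul_left_comm, ← Real.rpow_add hμ]
    norm_num
  rw [e, mul_assoc, ← Real.mul_rpow hB.le (by positivity)]
  gcongr 2 * ?_
  refine Real.rpow_le_rpow_of_nonpos (by positivity) ?_ (by norm_num)
  unfold level
  push_cast
  gcongr
  have : (0 : ℝ) ≤ k := Nat.cast_nonneg k
  linarith

theorem levelSum_nonneg {B : ℝ} (hB : 0 < B) : 0 ≤ levelSum B :=
  tsum_nonneg fun k => by have := level_pos hB k; positivity

end LandauFiber

end LandauBasis

end

/-! ### The distributional equation tested against eigenfunctions -/

noncomputable section

section FiberOperator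

open scoped InnerProductSpace

namespace LandauFiber

variable {B p : ℝ} {w : ℝ → ℝ}

theorem IsTest.memLp {φ : ℝ → ℝ} (hφ : IsTest φ) : MemLp φ 2 :=
  hφ.1.continuous.memLp_of_hasCompactSupport hφ.2

theorem IsTest.hasDerivAt {φ : ℝ → ℝ} (hφ : IsTest φ) (x : ℝ) :
    HasDerivAt φ (_root_.deriv φ x) x :=
  (hφ.1.differentiable (by simp) x).hasDerivAt

theorem locallyIntegrable_potential_smul (hw : MemLp w 2) (ψ : L2) :
    LocallyIntegrable (fun x => potential B w p x • ψ x) volume := by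
  have h1 : LocallyIntegrable (fun x => (p + B * x) ^ 2 • ψ x) volume :=
    (L2.locallyIntegrable ψ).continuous_smul (by fun_prop)
  have h2 : LocallyIntegrable (fun x => w x • ψ x) volume :=
    (integrable_smul_of_memLp_two hw (Lp.memLp ψ)).locallyIntegrable
  refine (h1.add h2).congr (Filter.Eventually.of_forall fun x => ?_)
  simp [potential, add_mul]

/-- The formal adjoint of the fiber operator, applied to a test function. -/
def formalAdjoint (B : ℝ) (w : ℝ → ℝ) (p : ℝ) (φ : ℝ → ℝ) (x : ℝ) : ℝ :=
  -deriv (deriv φ) x + φ x * potential B w p x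

theorem memLp_formalAdjoint (hw : MemLp w 2) {φ : ℝ → ℝ} (hφ : IsTest φ) :
    MemLp (formalAdjoint B w p φ) 2 := by
  obtain ⟨C, hC⟩ := hφ.2.exists_bound_of_continuous hφ.1.continuous
  have h1 : MemLp (fun x => φ x * (p + B * x) ^ 2) 2 :=
    (hφ.1.continuous.mul (by fun_prop)).memLp_of_hasCompactSupport hφ.2.mul_right
  have h2 := memLp_mul_of_bounded hw hφ.1.continuous hC
  refine MemLp.ae_eq (Filter.Eventually.of_forall fun x => ?_)
    ((hφ.deriv.deriv.memLp.neg.add h1).add h2)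
  simp only [Pi.add_apply, Pi.neg_apply, formalAdjoint, potential]
  ring

/-- All of the operator is moved onto the test function; local integrability is automatic because
`w` and `ψ` are both square-integrable. -/
theorem distribEq_iff (hw : MemLp w 2) (ψ g : L2) :
    DistribEq B w p ψ g ↔ ∀ φ, IsTest φ →
      ∫ x, formalAdjoint B w p φ x • ψ x = ∫ x, φ x • g x := by
  have key : ∀ φ, IsTest φ → ∫ x, formalAdjoint B w p φ x • ψ x
      = -(∫ x, deriv (deriv φ) x • ψ x) + ∫ x, φ x • (potential B w p x • ψ x) := fun φ hφ => by
    have i1 : Integrable fun x => -(deriv (deriv φ) x • ψ x) :=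
      (hφ.deriv.deriv.integrable_smul (L2.locallyIntegrable ψ)).neg
    rw [← integral_neg, ← integral_add i1
      (hφ.integrable_smul (locallyIntegrable_potential_smul hw ψ))]
    exact integral_congr_ae (Filter.Eventually.of_forall fun x => by
      simp only [formalAdjoint, add_smul, neg_smul, mul_smul])
  constructor
  · rintro ⟨_, h⟩ φ hφ
    rw [key φ hφ, h φ hφ]
  · intro h
    refine ⟨locallyIntegrable_potential_smul hw ψ, fun φ hφ => ?_⟩
    rw [← key φ hφ, h φ hφ]

theorem potential_eq (hB : 0 < B) (x : ℝ) :
    potential B w p x = (B * (x + p / B)) ^ 2 + w x := by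
  unfold potential
  field_simp
  ring

theorem hasDerivAt_landauFun_add (B a : ℝ) (k : ℕ) (x : ℝ) :
    HasDerivAt (fun x => landauFun B k (x + a)) (landauFunDeriv B k (x + a)) x :=
  (hasDerivAt_landauFun B k (x + a)).comp_add_const x a

theorem hasDerivAt_landauFunDeriv_add (B a : ℝ) (k : ℕ) (x : ℝ) :
    HasDerivAt (fun x => landauFunDeriv B k (x + a))
      (((B * (x + a)) ^ 2 - level B k) * landauFun B k (x + a)) x :=
  (hasDerivAt_landauFunDeriv B k (x + a)).comp_add_const x a

theorem continuous_landauFun_add (B a : ℝ) (k : ℕ) : Continuous fun x => landauFun B k (x + a) :=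
  (continuous_landauFun B k).comp (continuous_id.add continuous_const)

theorem continuous_landauFunDeriv_add (B a : ℝ) (k : ℕ) :
    Continuous fun x => landauFunDeriv B k (x + a) :=
  (continuous_landauFunDeriv B k).comp (continuous_id.add continuous_const)

/-- The basis functions lie in the domain of the fiber operator. -/
theorem integral_formalAdjoint_mul_landauFun (hB : 0 < B) (hw : MemLp w 2) {φ : ℝ → ℝ}
    (hφ : IsTest φ) (k : ℕ) :
    ∫ x, formalAdjoint B w p φ x * landauFun B k (x + p / B)
      = level B k * (∫ x, φ x * landauFun B k (x + p / B))
        + ∫ x, φ x * (w x * landauFun B k (x + p / B)) := by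
  set a := p / B with ha
  -- Green's identity: the derivative of this Wronskian-type expression integrates to zero.
  have hd : ∀ x, HasDerivAt
      (fun x => deriv φ x * landauFun B k (x + a) - φ x * landauFunDeriv B k (x + a))
      (deriv (deriv φ) x * landauFun B k (x + a)
        - φ x * (((B * (x + a)) ^ 2 - level B k) * landauFun B k (x + a))) x := fun x => by
    refine (((hφ.deriv.hasDerivAt x).mul (hasDerivAt_landauFun_add B a k x)).sub
      ((hφ.hasDerivAt x).mul (hasDerivAt_landauFunDeriv_add B a k x))).congr_deriv ?_
    ring
  have ci : ∀ {f g : ℝ → ℝ}, IsTest f → Continuous g → Integrable fun x => f x * g x :=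
    fun hf hg => (hf.1.continuous.mul hg).integrable_of_hasCompactSupport hf.2.mul_right
  have c0 := continuous_landauFun_add B a k
  have c1 := continuous_landauFunDeriv_add B a k
  have c2 : Continuous fun x => ((B * (x + a)) ^ 2 - level B k) * landauFun B k (x + a) := by
    fun_prop
  have i1 := ci hφ.deriv.deriv c0
  have i2 := ci hφ c2
  have h0 := integral_eq_zero_of_hasDerivAt_of_integrable hd (i1.sub i2)
    ((ci hφ.deriv c0).sub (ci hφ c1))
  have i3 : Integrable fun x => φ x * (w x * landauFun B k (x + a)) :=
    hφ.memLp.integrable_mul (memLp_mul_landauFun hB a hw k)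
  have i4 := (ci hφ c0).const_mul (level B k)
  rw [← integral_const_mul, ← integral_add i4 i3]
  have i5 : Integrable fun x => formalAdjoint B w p φ x * landauFun B k (x + a) :=
    (memLp_formalAdjoint hw hφ).integrable_mul (memLp_landauFun_add hB a k)
  have i6 : Integrable fun x => level B k * (φ x * landauFun B k (x + a))
      + φ x * (w x * landauFun B k (x + a)) := i4.add i3
  rw [← sub_eq_zero, ← integral_sub i5 i6, ← neg_eq_zero, ← integral_neg, ← h0]
  refine integral_congr_ae (Filter.Eventually.of_forall fun x => ?_)
  simp only [formalAdjoint, potential_eq hB, ← ha]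
  ring

theorem isTest_cutoff_mul_landauFun (χ : ContDiffBump (0 : ℝ)) {ε : ℝ} (hε : ε ≠ 0) (B a : ℝ)
    (k : ℕ) : IsTest fun x => χ (ε * x) * landauFun B k (x + a) := by
  constructor
  · have h1 : ContDiff ℝ ∞ fun x => χ (ε * x) :=
      (χ.contDiff (n := ⊤)).comp (contDiff_const.mul contDiff_id)
    have h2 : ContDiff ℝ ∞ fun x => landauFun B k (x + a) :=
      (contDiff_landauFun B k).comp (contDiff_id.add contDiff_const)
    exact h1.mul h2
  · have := χ.hasCompactSupport.comp_smul hε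
    exact HasCompactSupport.mul_right (by simpa using this)

/-- The commutator with the cutoff carries a factor `ε` or `ε²`, so it disappears as the cutoff
widens. -/
theorem formalAdjoint_cutoff_mul_landauFun (hB : 0 < B) (χ : ContDiffBump (0 : ℝ)) (ε : ℝ)
    (k : ℕ) (x : ℝ) :
    formalAdjoint B w p (fun x => χ (ε * x) * landauFun B k (x + p / B)) x
      = χ (ε * x) * (level B k * landauFun B k (x + p / B) + w x * landauFun B k (x + p / B))
        - (2 * ε * deriv χ (ε * x) * landauFunDeriv B k (x + p / B)
          + ε ^ 2 * deriv (deriv χ) (ε * x) * landauFun B k (x + p / B)) := by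
  set a := p / B with ha
  have hχ : IsTest χ := ⟨χ.contDiff (n := ⊤), χ.hasCompactSupport⟩
  have hχε : ∀ {f : ℝ → ℝ}, IsTest f → ∀ x,
      HasDerivAt (fun x => f (ε * x)) (ε * deriv f (ε * x)) x := fun hf x => by
    have := (hf.hasDerivAt (ε * x)).comp x ((hasDerivAt_id x).const_mul ε)
    refine this.congr_deriv ?_
    ring
  have h1 : deriv (fun x => χ (ε * x) * landauFun B k (x + a)) = fun x =>
      ε * deriv χ (ε * x) * landauFun B k (x + a) + χ (ε * x) * landauFunDeriv B k (x + a) :=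
    funext fun x => ((hχε hχ x).mul (hasDerivAt_landauFun_add B a k x)).deriv
  have h2 := ((((hχε hχ.deriv x).const_mul ε).mul (hasDerivAt_landauFun_add B a k x)).add
    ((hχε hχ x).mul (hasDerivAt_landauFunDeriv_add B a k x))).deriv
  simp only [formalAdjoint, potential_eq hB, ← ha]
  rw [h1]
  erw [h2]
  ring

/-- Coefficients of the distributional equation in the basis: this determines the maximal domain. -/
theorem DistribEq.integral_landauFun_smul (hB : 0 < B) (hw : MemLp w 2) {ψ g : L2}
    (h : DistribEq B w p ψ g) (k : ℕ) :
    ∫ x, (level B k * landauFun B k (x + p / B) + w x * landauFun B k (x + p / B)) • ψ x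
      = ∫ x, landauFun B k (x + p / B) • g x := by
  rw [distribEq_iff hw] at h
  set a := p / B with ha
  -- The eigenfunctions are not compactly supported, so they are cut off by `χ (ε x)` and `ε` is
  -- sent to zero by dominated convergence.
  let χ : ContDiffBump (0 : ℝ) := ⟨1, 2, one_pos, one_lt_two⟩
  have hχ : IsTest χ := ⟨χ.contDiff (n := ⊤), χ.hasCompactSupport⟩
  obtain ⟨C₁, hC₁⟩ := hχ.deriv.2.exists_bound_of_continuous hχ.deriv.1.continuous
  obtain ⟨C₂, hC₂⟩ := hχ.deriv.deriv.2.exists_bound_of_continuous hχ.deriv.deriv.1.continuous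
  let ε : ℕ → ℝ := fun N => 1 / ((N : ℝ) + 1)
  have hε0 : ∀ N, 0 < ε N := fun N => by positivity
  have hε1 : ∀ N, ε N ≤ 1 := fun N => by
    simp only [ε]
    rw [div_le_one (by positivity)]
    linarith [Nat.cast_nonneg (α := ℝ) N]
  have hεt : Filter.Tendsto ε Filter.atTop (nhds 0) := tendsto_one_div_add_atTop_nhds_zero_nat
  have hεx : ∀ x, Filter.Tendsto (fun N => ε N * x) Filter.atTop (nhds 0) := fun x => by
    simpa using hεt.mul_const x
  have hχt : ∀ x, Filter.Tendsto (fun N => χ (ε N * x)) Filter.atTop (nhds 1) := fun x => by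
    have h0 : χ 0 = 1 := χ.one_of_mem_closedBall (by simp [χ])
    rw [← h0]
    exact (χ.continuous.tendsto 0).comp (hεx x)
  let u : ℝ → ℝ := fun x => landauFun B k (x + a)
  let u' : ℝ → ℝ := fun x => landauFunDeriv B k (x + a)
  have hu : MemLp u 2 := memLp_landauFun_add hB a k
  have hu' : MemLp u' 2 := memLp_comp_add_right (memLp_landauFunDeriv hB k) a
  have hwu : MemLp (fun x => w x * u x) 2 := memLp_mul_landauFun hB a hw k
  let q : ℝ → ℝ := fun x => level B k * u x + w x * u x
  have hq : MemLp q 2 := (hu.const_mul _).add hwu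
  have hkey : ∀ N, ∫ x, (χ (ε N * x) * q x - (2 * ε N * deriv χ (ε N * x) * u' x
      + ε N ^ 2 * deriv (deriv χ) (ε N * x) * u x)) • ψ x
      = ∫ x, (χ (ε N * x) * u x) • g x := fun N => by
    rw [← h _ (isTest_cutoff_mul_landauFun χ (hε0 N).ne' B a k)]
    simp_rw [ha, formalAdjoint_cutoff_mul_landauFun hB]
    rfl
  have hχ1 : ∀ x, |χ x| ≤ 1 := fun x => by
    rw [abs_of_nonneg χ.nonneg]
    exact χ.le_one
  have cε : ∀ {f : ℝ → ℝ} N, IsTest f → Continuous fun x => f (ε N * x) := fun N hf =>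
    hf.1.continuous.comp (continuous_const.mul continuous_id)
  have lim1 : Filter.Tendsto (fun N => ∫ x, (χ (ε N * x) * u x) • g x) Filter.atTop
      (nhds (∫ x, u x • g x)) := by
    refine tendsto_integral_of_dominated_convergence (fun x => ‖u x • g x‖)
      (fun N => ((cε N hχ).aestronglyMeasurable.mul hu.1).smul (Lp.memLp g).1)
      (integrable_smul_of_memLp_two hu (Lp.memLp g)).norm
      (fun N => Filter.Eventually.of_forall fun x => ?_)
      (Filter.Eventually.of_forall fun x => ?_)
    · rw [norm_smul, norm_smul, norm_mul, Real.norm_eq_abs (χ _)]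
      gcongr
      exact mul_le_of_le_one_left (norm_nonneg _) (hχ1 _)
    · have := ((hχt x).mul_const (u x)).smul_const (g x)
      simpa using this
  have lim2 : Filter.Tendsto (fun N => ∫ x, (χ (ε N * x) * q x
      - (2 * ε N * deriv χ (ε N * x) * u' x
      + ε N ^ 2 * deriv (deriv χ) (ε N * x) * u x)) • ψ x) Filter.atTop
      (nhds (∫ x, q x • ψ x)) := by
    refine tendsto_integral_of_dominated_convergence
      (fun x => ‖(|q x| + (2 * C₁ * |u' x| + C₂ * |u x|)) • ψ x‖)
      (fun N => ?_) ?_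
      (fun N => Filter.Eventually.of_forall fun x => ?_)
      (Filter.Eventually.of_forall fun x => ?_)
    · have m1 := (cε N hχ).aestronglyMeasurable.mul hq.1
      have m2 := ((continuous_const (y := 2 * ε N)).mul
        (cε N hχ.deriv)).aestronglyMeasurable.mul hu'.1
      have m3 := ((continuous_const (y := ε N ^ 2)).mul
        (cε N hχ.deriv.deriv)).aestronglyMeasurable.mul hu.1
      exact (m1.sub (m2.add m3)).smul (Lp.memLp ψ).1
    · exact (integrable_smul_of_memLp_two
        (hq.abs.add ((hu'.abs.const_mul _).add (hu.abs.const_mul _))) (Lp.memLp ψ)).norm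
    · have hC₁0 : 0 ≤ C₁ := (norm_nonneg _).trans (hC₁ 0)
      have hC₂0 : 0 ≤ C₂ := (norm_nonneg _).trans (hC₂ 0)
      have e1 := hε0 N
      have e2 := hε1 N
      rw [norm_smul, norm_smul]
      gcongr
      rw [Real.norm_eq_abs, Real.norm_eq_abs]
      refine le_trans ((abs_sub _ _).trans (add_le_add ?_ ((abs_add_le _ _).trans
        (add_le_add ?_ ?_)))) (le_abs_self _)
      · rw [abs_mul]
        exact mul_le_of_le_one_left (abs_nonneg _) (hχ1 _)
      · rw [abs_mul, abs_mul, abs_mul, abs_two, abs_of_pos e1]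
        refine mul_le_mul_of_nonneg_right ?_ (abs_nonneg _)
        calc 2 * ε N * |deriv χ (ε N * x)| ≤ 2 * 1 * C₁ := by
              gcongr
              exact hC₁ _
          _ = 2 * C₁ := by ring
      · rw [abs_mul, abs_mul, abs_pow, abs_of_pos e1]
        refine mul_le_mul_of_nonneg_right ?_ (abs_nonneg _)
        calc ε N ^ 2 * |deriv (deriv χ) (ε N * x)| ≤ 1 ^ 2 * C₂ := by
              gcongr
              exact hC₂ _
          _ = C₂ := by ring
    · have t1 := (hχt x).mul_const (q x)
      have d1 := (hχ.deriv.1.continuous.tendsto 0).comp (hεx x)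
      have d2 := (hχ.deriv.deriv.1.continuous.tendsto 0).comp (hεx x)
      have t2 := ((hεt.const_mul 2).mul d1).mul_const (u' x)
      have t3 := ((hεt.pow 2).mul d2).mul_const (u x)
      have := (t1.sub (t2.add t3)).smul_const (ψ x)
      simpa using this
  simp_rw [hkey] at lim2
  exact tendsto_nhds_unique lim2 lim1

end LandauFiber

end FiberOperator

end

/-! ### The fiber operator as a perturbation and its eigenvalues -/

noncomputable section

section Spectrum

open scoped InnerProductSpace

namespace LandauFiber

variable {B : ℝ} {w : ℝ → ℝ}

/-- The fiber operator is `(1 + K) R⁻¹`, where `R` inverts the unperturbed operator and `K` is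
multiplication by the potential after `R`. -/
theorem exists_isPerturbation (hB : 0 < B) (hw : MemLp w 2) (p : ℝ) :
    ∃ R K : L2 →L[ℂ] L2,
      IsPerturbation (landauBasis hB (p / B)) B R K √(levelSum B * ∫ x, w x ^ 2) ∧
      (∀ k, level B k * (⟪landauBasis hB (p / B) k, K (landauBasis hB (p / B) k)⟫_ℂ).re
        = ∫ x, w x * landauFun B k (x + p / B) ^ 2) ∧
      (√(levelSum B * ∫ x, w x ^ 2) < 1 → ∀ ψ g : L2,
        (ψ, g) ∈ fiberGraph B w p ↔ ∃ c, ψ = R c ∧ g = c + K c) := by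
  set a := p / B with ha
  set b := landauBasis hB a with hb
  set δ := √(levelSum B * ∫ x, w x ^ 2) with hδ
  have hw0 : 0 ≤ ∫ x, w x ^ 2 := integral_nonneg fun _ => sq_nonneg _
  let W : ℕ → L2 := fun k => toL2 _ (memLp_mul_landauFun hB a hw k)
  let y : ℕ → L2 := fun k => (((level B k)⁻¹ : ℝ) : ℂ) • W k
  have hμ : ∀ k, (level B k : ℂ) ≠ 0 := fun k => by exact_mod_cast (level_pos hB k).ne'
  have hyle : ∀ k, ‖y k‖ ^ 2 ≤ (level B k)⁻¹ ^ 2 * (2 * √(level B k)) * ∫ x, w x ^ 2 := fun k => by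
    rw [norm_smul, mul_pow, Complex.norm_real, Real.norm_eq_abs, sq_abs, mul_assoc]
    gcongr
    exact norm_mul_landauFun_sq_le hB a hw k
  have hys : Summable fun k => ‖y k‖ ^ 2 :=
    .of_nonneg_of_le (fun _ => by positivity) hyle ((summable_level hB).mul_right _)
  -- Formally `A` is `R` after multiplication by `w`, and its adjoint `K` is multiplication by `w`
  -- after `R`. Working with `A` first requires only square-summable rows, whose norm bound is
  -- independent of `p`.
  obtain ⟨A, hA, hAn⟩ := b.exists_clm_of_rows y (Real.sqrt_nonneg _) hys (C := δ) (by
    rw [Real.sq_sqrt (mul_nonneg (levelSum_nonneg hB) hw0), levelSum, ← tsum_mul_right]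
    exact hys.tsum_le_tsum hyle ((summable_level hB).mul_right _))
  obtain ⟨R, hR, -⟩ := b.exists_diagonal (fun k => (level B k)⁻¹) (D := B⁻¹) (fun k => by
    rw [abs_of_pos (inv_pos.2 (level_pos hB k))]
    exact inv_anti₀ hB (le_level hB k))
  let K : L2 →L[ℂ] L2 := ContinuousLinearMap.adjoint A
  have hKn : ‖K‖ ≤ δ := by
    rw [LinearIsometryEquiv.norm_map]
    exact hAn
  have hKb : ∀ k, K (b k) = y k := fun k => ext_inner_left ℂ fun ψ => by
    rw [ContinuousLinearMap.adjoint_inner_right, ← inner_conj_symm, hA, inner_conj_symm]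
  have hRb : ∀ k, R (b k) = (((level B k)⁻¹ : ℝ) : ℂ) • b k := fun k => b.ext_inner fun j => by
    rw [hR, inner_smul_right, orthonormal_iff_ite.1 b.orthonormal]
    split_ifs with hjk
    · rw [hjk]
    · simp
  have hbW : ∀ j k, ⟪b j, W k⟫_ℂ
      = ((∫ x, landauFun B j (x + a) * (w x * landauFun B k (x + a)) : ℝ) : ℂ) := fun j k => by
    rw [hb, landauBasis_apply, inner_toL2_toL2]
  have hWb : ∀ j k, ⟪W j, b k⟫_ℂ = ⟪b j, W k⟫_ℂ := fun j k => by
    rw [hbW, hb, landauBasis_apply, inner_toL2_toL2]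
    congr 1
    exact integral_congr_ae (Filter.Eventually.of_forall fun x => by ring)
  -- Both sides are formally `R w R`; this encodes the symmetry of the potential.
  have hAR : A ∘L R = R ∘L K := b.clm_ext fun k => b.ext_inner fun j => by
    simp only [ContinuousLinearMap.comp_apply]
    rw [hRb, map_smul, inner_smul_right, hA, hKb, hR, inner_smul_left, inner_smul_right, hWb,
      Complex.conj_ofReal]
    ring
  have hpert : IsPerturbation b B R K δ := ⟨hB, hR, fun x z => by
    have h1 : A (R x) = R (K x) := DFunLike.congr_fun hAR x
    rw [ContinuousLinearMap.adjoint_inner_right, h1, b.inner_diagonal_left hR], hKn⟩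
  refine ⟨R, K, hpert, fun k => ?_, fun hδ1 ψ g => ⟨fun hmem => ?_, ?_⟩⟩
  · rw [hKb, inner_smul_right, hbW, ← Complex.ofReal_mul, Complex.ofReal_re, ← mul_assoc,
      mul_inv_cancel₀ (level_pos hB k).ne', one_mul]
    exact integral_congr_ae (Filter.Eventually.of_forall fun x => by ring)
  · have hcoef := DistribEq.integral_landauFun_smul hB hw hmem
    -- Testing against `b k` and dividing by the level gives the equation in the bounded form `R g =
    -- (1 + A) ψ`.
    have hRg : R g = ψ + A ψ := b.ext_inner fun k => by
      have h1 := hcoef k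
      have h2 : ∫ x, (level B k * landauFun B k (x + p / B)
          + w x * landauFun B k (x + p / B)) • ψ x
          = level B k * ⟪b k, ψ⟫_ℂ + ⟪W k, ψ⟫_ℂ := by
        rw [hb, landauBasis_apply, inner_toL2, inner_toL2, ← integral_const_mul, ← integral_add]
        · exact integral_congr_ae (Filter.Eventually.of_forall fun x => by
            simp only [Complex.real_smul]
            push_cast
            ring)
        · exact (integrable_smul_of_memLp_two (memLp_landauFun_add hB a k) (Lp.memLp ψ)).const_mul _
        · exact integrable_smul_of_memLp_two (memLp_mul_landauFun hB a hw k) (Lp.memLp ψ)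
      have h3 : ∫ x, landauFun B k (x + p / B) • g x = ⟪b k, g⟫_ℂ := by
        rw [hb, landauBasis_apply, inner_toL2]
      rw [h2, h3] at h1
      rw [hR, ← h1, inner_add_right, hA, inner_smul_left, Complex.conj_ofReal, mul_add]
      push_cast
      rw [inv_mul_cancel_left₀ (hμ k)]
    -- `1 + K` is inverted by a Neumann series; then `(1 + A)(ψ - R c) = 0` and `‖A‖ < 1` force `ψ =
    -- R c`.
    obtain ⟨c, hc⟩ : ∃ c, c + K c = g := by
      have hu : IsUnit (1 - -K) := isUnit_one_sub_of_norm_lt_one (by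
        rw [norm_neg]
        exact hKn.trans_lt hδ1)
      obtain ⟨S, hS⟩ := hu.exists_right_inv
      refine ⟨S g, ?_⟩
      have := DFunLike.congr_fun hS g
      simpa using this
    refine ⟨c, ?_, hc.symm⟩
    have h4 : (ψ - R c) + A (ψ - R c) = 0 := by
      have h5 : A (R c) = R (K c) := DFunLike.congr_fun hAR c
      rw [← hc, map_add] at hRg
      rw [map_sub, h5, sub_add_sub_comm, ← hRg, sub_self]
    have h5 : ‖ψ - R c‖ ≤ δ * ‖ψ - R c‖ := by
      calc ‖ψ - R c‖ = ‖A (ψ - R c)‖ := by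
            conv_lhs => rw [eq_neg_of_add_eq_zero_left h4, norm_neg]
        _ ≤ _ := A.le_of_opNorm_le hAn _
    have h6 : ‖ψ - R c‖ = 0 := by nlinarith [norm_nonneg (ψ - R c)]
    exact sub_eq_zero.1 (norm_eq_zero.1 h6)
  · rintro ⟨c, rfl, rfl⟩
    refine (distribEq_iff hw _ _).2 fun φ hφ => ?_
    have hq := memLp_formalAdjoint (B := B) (p := p) hw hφ
    rw [← inner_toL2 hq, ← inner_toL2 hφ.memLp]
    -- Both sides are continuous and linear in `c`, so the weak equation need only be checked on
    -- basis vectors.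
    have h1 : (innerSL ℂ (toL2 _ hq)) ∘L R
        = (innerSL ℂ (toL2 _ hφ.memLp)) ∘L (ContinuousLinearMap.id ℂ L2 + K) :=
      b.clm_ext fun k => by
        simp only [ContinuousLinearMap.comp_apply, innerSL_apply_apply,
          _root_.add_apply, ContinuousLinearMap.id_apply]
        rw [hRb, hKb, inner_add_right, inner_smul_right, inner_smul_right, hb, landauBasis_apply,
          inner_toL2_toL2, inner_toL2_toL2, inner_toL2_toL2,
          integral_formalAdjoint_mul_landauFun hB hw hφ k, ← ha]
        push_cast
        rw [mul_add, inv_mul_cancel_left₀ (hμ k)]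
    exact DFunLike.congr_fun h1 c

theorem isEigenvalue_fiberOperator_iff {p E : ℝ} :
    IsEigenvalue (fiberOperator B w p) E ↔
      ∃ ψ : L2, ψ ≠ 0 ∧ (ψ, (E : ℂ) • ψ) ∈ fiberGraph B w p := by
  simp only [← fiberOperator_graph, LinearPMap.mem_graph_iff]
  constructor
  · rintro ⟨ψ, h0, h⟩
    exact ⟨ψ, h0, ψ, rfl, h⟩
  · rintro ⟨_, h0, ψ, rfl, h⟩
    exact ⟨ψ, h0, h⟩

theorem isEigenvalue_iff_isLevel {p δ : ℝ} {b : HilbertBasis ℕ ℂ L2} {R K : L2 →L[ℂ] L2}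
    (h : IsPerturbation b B R K δ)
    (hg : ∀ ψ g : L2, (ψ, g) ∈ fiberGraph B w p ↔ ∃ c, ψ = R c ∧ g = c + K c) (E : ℝ) :
    IsEigenvalue (fiberOperator B w p) E ↔ IsLevel R K E := by
  rw [isEigenvalue_fiberOperator_iff]
  constructor
  · rintro ⟨ψ, h0, hψ⟩
    obtain ⟨c, rfl, hc⟩ := (hg _ _).1 hψ
    exact ⟨c, fun hc0 => h0 (by rw [hc0, map_zero]), hc.symm⟩
  · rintro ⟨c, hc0, hc⟩
    exact ⟨R c, fun h0 => hc0 (h.R_injective h0), (hg _ _).2 ⟨c, rfl, hc.symm⟩⟩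

theorem eigenvalueBranch_spec {v : ℝ → ℝ} {j : ℕ} {p E : ℝ}
    (h : IsNthEigenvalue (fiberOperator B v p) j E) : eigenvalueBranch B v j p = E := by
  have hex : ∃ E : ℝ, IsNthEigenvalue (fiberOperator B v p) j E := ⟨E, h⟩
  rw [eigenvalueBranch, dif_pos hex]
  exact hex.choose_spec.unique h

/-- First order perturbation theory for the eigenvalue branches. -/
theorem eigenvalueBranch_first_order (hB : 0 < B) (hw : MemLp w 2) {n : ℕ} {δ : ℝ}
    (hδ : δ = √(levelSum B * ∫ x, w x ^ 2)) (hsmall : 8 * (2 * n + 3) ^ 2 * δ ≤ 1)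
    {j : ℕ} (hj : j ≤ n) (p : ℝ) :
    IsNthEigenvalue (fiberOperator B w p) j (eigenvalueBranch B w j p) ∧
      |eigenvalueBranch B w j p
          - (level B j + ∫ x, w x * landauFun B j (x + p / B) ^ 2)|
        ≤ level B j * (4 * (2 * j + 3) ^ 2 * δ ^ 2) := by
  obtain ⟨R, K, hpert, hfirst, hgraph⟩ := exists_isPerturbation hB hw p
  rw [← hδ] at hpert hgraph
  have hδ1 : δ < 1 := by
    nlinarith [Nat.cast_nonneg (α := ℝ) n, hpert.nonneg,
      mul_nonneg (Nat.cast_nonneg (α := ℝ) n) hpert.nonneg,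
      mul_nonneg (Nat.cast_nonneg (α := ℝ) n)
        (mul_nonneg (Nat.cast_nonneg (α := ℝ) n) hpert.nonneg)]
  have hiff := isEigenvalue_iff_isLevel hpert (hgraph hδ1)
  obtain ⟨E, hE⟩ := hpert.exists_levels_encard hsmall
  obtain ⟨h1, h2, h3⟩ := hE j hj
  have hnth : IsNthEigenvalue (fiberOperator B w p) j (E j) := by
    refine ⟨(hiff _).2 h1, ?_⟩
    simp_rw [hiff]
    exact h2
  rw [eigenvalueBranch_spec hnth]
  refine ⟨hnth, ?_⟩
  rwa [mul_add, mul_one, hfirst] at h3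

end LandauFiber

end Spectrum

end

/-! ### Conclusion for small coupling -/

theorem proposition3p2 (B : ℝ) (hB : 0 < B) (v : ℝ → ℝ)
    (hv : MemLp v 2 (volume : Measure ℝ)) (hv0 : ¬ (v =ᵐ[volume] 0)) (n : ℕ) :
    ∃ lam_n : ℝ, 0 < lam_n ∧ ∀ lam : ℝ, 0 < lam → lam < lam_n → ∀ j : ℕ, j ≤ n →
      (∀ p : ℝ, LandauFiber.IsNthEigenvalue
        (LandauFiber.fiberOperator B (fun x => lam * v x) p) j
        (LandauFiber.eigenvalueBranch B (fun x => lam * v x) j p)) ∧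
      ∃ p q : ℝ, LandauFiber.eigenvalueBranch B (fun x => lam * v x) j p
        ≠ LandauFiber.eigenvalueBranch B (fun x => lam * v x) j q := by
  choose s t hst using LandauFiber.exists_integral_mul_landauFun_sq_ne hv hv0 hB
  set c : ℕ → ℝ → ℝ := fun j s => ∫ x, v x * LandauFiber.landauFun B j (x + s) ^ 2 with hc
  set D := √(LandauFiber.levelSum B * ∫ x, v x ^ 2) with hD
  set G : ℕ → ℝ := fun j => LandauFiber.level B j * (4 * (2 * j + 3) ^ 2 * D ^ 2) with hG
  -- At coupling `lam` the first order term is `lam * c j`, with error at most `lam² * G j`.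
  -- Comparing two momenta doubles the error, hence the factor `2` after one `lam` is cancelled.
  -- Only finitely many `j` occur, so one threshold serves all.
  have hsmall : ∀ᶠ lam in nhdsWithin (0 : ℝ) (Set.Ioi 0),
      8 * (2 * (n : ℝ) + 3) ^ 2 * (lam * D) ≤ 1 ∧
        ∀ j ∈ Finset.range (n + 1), 2 * (lam * G j) < |c j (s j) - c j (t j)| := by
    refine Filter.Eventually.and ?_ ((Filter.eventually_all_finset _).2 fun j _ => ?_)
    · have h1 : Filter.Tendsto (fun lam : ℝ => 8 * (2 * (n : ℝ) + 3) ^ 2 * (lam * D))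
          (nhdsWithin 0 (Set.Ioi 0)) (nhds (8 * (2 * (n : ℝ) + 3) ^ 2 * (0 * D))) :=
        (Continuous.tendsto (by fun_prop) 0).mono_left nhdsWithin_le_nhds
      exact h1.eventually_le_const (by norm_num)
    · have h1 : Filter.Tendsto (fun lam : ℝ => 2 * (lam * G j))
          (nhdsWithin 0 (Set.Ioi 0)) (nhds (2 * (0 * G j))) :=
        (Continuous.tendsto (by fun_prop) 0).mono_left nhdsWithin_le_nhds
      refine h1.eventually_lt_const ?_
      rw [zero_mul, mul_zero]
      exact abs_pos.2 (sub_ne_zero.2 (hst j))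
  obtain ⟨lam_n, hpos, hsub⟩ := mem_nhdsGT_iff_exists_Ioo_subset.1 hsmall
  refine ⟨lam_n, hpos, fun lam hlam hlt j hj => ?_⟩
  obtain ⟨h1, h2⟩ := hsub ⟨hlam, hlt⟩
  have hw : MemLp (fun x => lam * v x) 2 := hv.const_mul lam
  have hδ : lam * D = √(LandauFiber.levelSum B * ∫ x, (lam * v x) ^ 2) := by
    simp_rw [mul_pow]
    rw [integral_const_mul, mul_left_comm, Real.sqrt_mul (sq_nonneg lam), Real.sqrt_sq hlam.le]
  have hmain := fun p => LandauFiber.eigenvalueBranch_first_order hB hw hδ h1 hj p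
  -- The momentum `B s` translates the eigenfunctions by `s`.
  refine ⟨fun p => (hmain p).1, B * s j, B * t j, fun heq => ?_⟩
  have hp := (hmain (B * s j)).2
  have hq := (hmain (B * t j)).2
  have hint : ∀ s, ∫ x, lam * v x * LandauFiber.landauFun B j (x + s) ^ 2 = lam * c j s :=
    fun s => by simp_rw [mul_assoc, integral_const_mul, hc]
  rw [mul_div_cancel_left₀ _ hB.ne', hint] at hp hq
  rw [← heq] at hq
  have hgap : |lam * (c j (s j) - c j (t j))| ≤ lam * (2 * (lam * G j)) := by
    have e : LandauFiber.level B j * (4 * (2 * j + 3) ^ 2 * (lam * D) ^ 2)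
        = lam * (lam * G j) := by simp only [hG]; ring
    rw [e, abs_le] at hp hq
    rw [abs_le]
    constructor <;> linarith [hp.1, hp.2, hq.1, hq.2]
  rw [abs_mul, abs_of_pos hlam] at hgap
  exact absurd (le_of_mul_le_mul_left hgap hlam)
    (not_le.2 (h2 j (Finset.mem_range.2 (Nat.lt_succ_of_le hj))))
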